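/- Let $\mathcal B$ be a unital $C^*$-algebra. For a (right) Hilbert $\mathcal B$-module $F$, let $\mathcal B^a(F)$ be the algebra of adjointable operators on $F$, and call $F$ full if the closed linear span of $\langle F,F\rangle$ is $\mathcal B$. A correspondence over $\mathcal B$ is a Hilbert $\mathcal B$-module with a nondegenerate left action of $\mathcal B$ by adjointable operators (a $*$-homomorphism $\mathcal B\to\mathcal B^a(E)$). A unital ($*$-)endomorphism $\vartheta$ of $\mathcal B^a(F)$ is strict if it is continuous on bounded subsets for the strict topology (the one given by the seminorms $a\mapsto\|ax\|$, $a\mapsto\|a^*x\|$, $x\in F$). The correspondence over $\mathcal B$ associated with such a $\vartheta$ is $F_\vartheta := F^*\odot{}_\vartheta F$. Here ${}_\vartheta F$ is $F$ with left action $a.x=\vartheta(a)x$ of $\mathcal B^a(F)$, and $F^*=\{x^*:x\in F\}$ is the dual correspondence from $\mathcal B$ to $\mathcal B^a(F)$, with $\langle x^*,y^*\rangle=xy^*\colon z\mapsto x\langle y,z\rangle$ and $bx^*=(xb^*)^*$. The internal tensor product $X\odot Y$ is the correspondence generated by elements $x\odot y$ with $\langle x\odot y,x'\odot y'\rangle=\langle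 y,\langle x,x'\rangle y'\rangle$ and $a(x\odot y)=(ax)\odot y$. Theorem. Let $E$ be a full correspondence over a unital $C^*$-algebra $\mathcal B$. Then there are a full Hilbert $\mathcal B$-module $F$ and a strict unital endomorphism $\vartheta$ of $\mathcal B^a(F)$ such that $F_\vartheta\cong E$ as correspondences over $\mathcal B$, and such that $F\odot E\cong F$ by an isomorphism of Hilbert $\mathcal B$-modules that identifies $a\odot\mathrm{id}_E$ with $\vartheta(a)$ for all $a\in\mathcal B^a(F)$. Fullness of $F$ is necessary: whenever $F$ is a Hilbert $\mathcal B$-module and $\vartheta$ is a strict unital endomorphism of $\mathcal B^a(F)$ with $F_\vartheta\cong E$, then $F$ is full. -/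

import Mathlib

open scoped InnerProductSpace RightActions

/-!
Conventions.  A Hilbert `B`-module over a C⋆-algebra `B` is a complete right `B`-module with a
`B`-valued inner product that is `B`-linear in the *second* variable.  A right `B`-module is a
`Module Bᵐᵒᵖ E`, and such a Hilbert module is Mathlib's `CStarModule Bᵐᵒᵖ E` together with
`CompleteSpace E`; the `B`-valued inner product is `HilbMod.ip`.
-/

universe u v w

namespace HilbMod

section Basic

variable {B : Type u} [CStarAlgebra B] [PartialOrder B] [StarOrderedRing B]
variable {E : Type v} [NormedAddCommGroup E] [NormedSpace ℂ E] [Module Bᵐᵒᵖ E]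
  [CStarModule Bᵐᵒᵖ E]

/-- The `B`-valued inner product `⟨x, y⟩` of a right Hilbert `B`-module. -/
def ip (B : Type u) [CStarAlgebra B] [PartialOrder B] [StarOrderedRing B]
    {E : Type v} [NormedAddCommGroup E] [NormedSpace ℂ E] [Module Bᵐᵒᵖ E]
    [CStarModule Bᵐᵒᵖ E] (x y : E) : B :=
  MulOpposite.unop (⟪x, y⟫_Bᵐᵒᵖ)

theorem ip_def (x y : E) : ip B x y = MulOpposite.unop (⟪x, y⟫_Bᵐᵒᵖ) := rfl

theorem ip_add_right (x y z : E) : ip B x (y + z) = ip B x y + ip B x z := by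
  simp [ip]

theorem ip_sub_right (x y z : E) : ip B x (y - z) = ip B x y - ip B x z := by
  simp [ip]

theorem ip_smul_right (c : ℂ) (x y : E) : ip B x (c • y) = c • ip B x y := by
  simp [ip]

theorem ip_mul_right (b : B) (x y : E) : ip B x (y <• b) = ip B x y * b := by
  simp [ip]

theorem star_ip (x y : E) : star (ip B x y) = ip B y x := by
  rw [ip, ← MulOpposite.unop_star, CStarModule.star_inner, ip]

theorem ip_mul_left (b : B) (x y : E) : ip B (x <• b) y = star b * ip B x y := by
  rw [← star_ip, ip_mul_right, star_mul, star_ip]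

theorem ip_self_eq_zero (x : E) : ip B x x = 0 ↔ x = 0 := by
  rw [ip, MulOpposite.unop_eq_zero_iff, CStarModule.inner_self]

theorem norm_sq_eq (x : E) : ‖x‖ ^ 2 = ‖ip B x x‖ := by
  rw [CStarModule.norm_sq_eq (A := Bᵐᵒᵖ), ip, MulOpposite.norm_unop]

theorem norm_ip_le (x y : E) : ‖ip B x y‖ ≤ ‖x‖ * ‖y‖ := by
  rw [ip, MulOpposite.norm_unop]
  exact CStarModule.norm_inner_le E

/-- Two vectors with the same inner products are equal. -/
theorem ext_ip {x y : E} (h : ∀ z : E, ip B z x = ip B z y) : x = y := by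
  rw [← sub_eq_zero, ← ip_self_eq_zero (B := B), ip_sub_right, h, sub_self]

theorem norm_rmul_le (x : E) (b : B) : ‖x <• b‖ ≤ ‖x‖ * ‖b‖ := by
  refine le_of_sq_le_sq ?_ (by positivity)
  rw [norm_sq_eq (B := B), ip_mul_right, ip_mul_left, mul_pow, norm_sq_eq (B := B) x]
  calc ‖star b * ip B x x * b‖ ≤ ‖star b‖ * ‖ip B x x‖ * ‖b‖ :=
        (norm_mul_le _ _).trans (by gcongr; exact norm_mul_le _ _)
    _ = ‖ip B x x‖ * ‖b‖ ^ 2 := by rw [norm_star]; ring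

variable (B E) in
/-- A Hilbert `B`-module is full if the closed linear span of all `⟨x, y⟩` is `B`. -/
def IsFull : Prop :=
  (Submodule.span ℂ (Set.range fun p : E × E => ip B p.1 p.2)).topologicalClosure = ⊤

end Basic

section Adjointable

variable (B : Type u) [CStarAlgebra B] [PartialOrder B] [StarOrderedRing B]
variable (E : Type v) [NormedAddCommGroup E] [NormedSpace ℂ E] [Module Bᵐᵒᵖ E]
  [CStarModule Bᵐᵒᵖ E]

/-- The algebra of adjointable operators on `E`, as a subalgebra of the bounded operators
(adjointable operators are automatically `B`-linear and, on a complete `E`, bounded). -/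
def adjointable : Subalgebra ℂ (E →L[ℂ] E) where
  carrier := {a | ∃ a' : E →L[ℂ] E, ∀ x y : E, ip B (a x) y = ip B x (a' y)}
  mul_mem' := by
    rintro a b ⟨a', ha⟩ ⟨b', hb⟩
    exact ⟨b' * a', fun x y => by simp [ha, hb]⟩
  add_mem' := by
    rintro a b ⟨a', ha⟩ ⟨b', hb⟩
    refine ⟨a' + b', fun x y => ?_⟩
    have h1 : ip B (a x + b x) y = ip B (a x) y + ip B (b x) y := by
      rw [← star_ip, ip_add_right, star_add, star_ip, star_ip]
    simp [h1, ha, hb, ip_add_right]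
  algebraMap_mem' := by
    intro c
    refine ⟨algebraMap ℂ _ (star c), fun x y => ?_⟩
    simp only [ContinuousLinearMap.algebraMap_apply]
    rw [← star_ip, ip_smul_right, star_smul, star_ip, ip_smul_right]

/-- `𝓑ᵃ(E)`, the algebra of all adjointable operators on `E`, with the operator norm. -/
abbrev Ba : Type v := ↥(adjointable B E)

variable {B E}

noncomputable instance : Star (Ba B E) where
  star a := ⟨a.2.choose, a.1, fun x y => by
    rw [← star_ip, ← a.2.choose_spec, star_ip]⟩

/-- The defining property of the adjoint. -/
theorem ip_star_right (a : Ba B E) (x y : E) :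
    ip B x ((star a : Ba B E).1 y) = ip B (a.1 x) y :=
  (a.2.choose_spec x y).symm

theorem eq_star_of_ip {a b : Ba B E} (h : ∀ x y : E, ip B x (b.1 y) = ip B (a.1 x) y) :
    b = star a := by
  apply Subtype.ext
  ext y
  exact ext_ip (B := B) fun z => by rw [h, ip_star_right]

noncomputable instance : StarRing (Ba B E) where
  star_involutive a := (eq_star_of_ip fun x y => by
    rw [← star_ip, ← ip_star_right, star_ip]).symm
  star_mul a b := (eq_star_of_ip fun x y => by
    change ip B x ((star b : Ba B E).1 ((star a : Ba B E).1 y)) = ip B (a.1 (b.1 x)) y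
    rw [ip_star_right, ip_star_right]).symm
  star_add a b := (eq_star_of_ip fun x y => by
    change ip B x ((star a : Ba B E).1 y + (star b : Ba B E).1 y) = ip B (a.1 x + b.1 x) y
    rw [ip_add_right, ip_star_right, ip_star_right, ← star_ip y (a.1 x + b.1 x), ip_add_right,
      star_add, star_ip, star_ip]).symm

/-- The rank-one operator `x y* : z ↦ x ⟨y, z⟩`. -/
noncomputable def rankOneCLM (B : Type u) [CStarAlgebra B] [PartialOrder B] [StarOrderedRing B]
    {E : Type v} [NormedAddCommGroup E] [NormedSpace ℂ E] [Module Bᵐᵒᵖ E]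
    [CStarModule Bᵐᵒᵖ E] (x y : E) : E →L[ℂ] E :=
  LinearMap.mkContinuous
    { toFun := fun z => x <• ip B y z
      map_add' := fun z z' => by rw [ip_add_right, MulOpposite.op_add, add_smul]
      map_smul' := fun c z => ext_ip (B := B) fun w => by
        rw [ip_mul_right, ip_smul_right, RingHom.id_apply, ip_smul_right, ip_mul_right,
          mul_smul_comm] }
    (‖x‖ * ‖y‖) fun z => by
      refine (norm_rmul_le x (ip B y z)).trans ?_
      rw [mul_assoc]
      exact mul_le_mul_of_nonneg_left (norm_ip_le y z) (norm_nonneg x)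

theorem rankOneCLM_apply (x y z : E) : rankOneCLM B x y z = x <• ip B y z := rfl

/-- The rank-one operator `x y*` as an adjointable operator; its adjoint is `y x*`. -/
noncomputable def rankOne (x y : E) : Ba B E :=
  ⟨rankOneCLM B x y, rankOneCLM B y x, fun z w => by
    rw [rankOneCLM_apply, rankOneCLM_apply, ip_mul_left, star_ip, ip_mul_right]⟩

variable (B E) in
/-- The strict topology of `𝓑ᵃ(E)`: the topology of the seminorms `a ↦ ‖a x‖` and
`a ↦ ‖a* x‖`, for `x ∈ E`. -/
@[reducible]
noncomputable def strictTopology : TopologicalSpace (Ba B E) :=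
  TopologicalSpace.induced
    (fun a : Ba B E => ((fun x : E => a.1 x), (fun x : E => (star a : Ba B E).1 x)))
    (inferInstance : TopologicalSpace ((E → E) × (E → E)))

/-- A map `𝓑ᵃ(E) → 𝓑ᵃ(E)` is strict if it is strictly continuous on bounded subsets. -/
def IsStrict (ϑ : Ba B E → Ba B E) : Prop :=
  ∀ S : Set (Ba B E), Bornology.IsBounded S →
    @ContinuousOn _ _ (strictTopology B E) (strictTopology B E) ϑ S

/-- A left action of `A` on `E` by adjointable operators is nondegenerate if the vectors `a x`
span a dense subspace of `E`.  A Hilbert `B`-module `E` with a nondegenerate left action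
`A →⋆ₙₐ[ℂ] Ba B E` is a correspondence from `A` to `B`. -/
def IsNondegenerate {A : Type w} (π : A → Ba B E) : Prop :=
  (Submodule.span ℂ (Set.range fun p : A × E => (π p.1).1 p.2)).topologicalClosure = ⊤

end Adjointable

section Tensor

variable {B : Type u} [CStarAlgebra B] [PartialOrder B] [StarOrderedRing B]

/-- `IsInternalTensor lX ipX σ τ t` says that the correspondence `G` from `A` to `B` is the
internal tensor product `X ⊙ Y` of a correspondence `X` from `A` to `C` and a correspondence `Y`
from `C` to `B`, with elementary tensors `t x y = x ⊙ y`.  Here `lX` is the left action of `A` on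
`X`, `ipX` is the `C`-valued inner product of `X`, `σ` is the left action of `C` on `Y`, and `τ`
is the left action of `A` on `G`.  That is, `t` is left `A`-linear, satisfies
`⟨x ⊙ y, x' ⊙ y'⟩ = ⟨y, ⟨x, x'⟩ y'⟩`, and its range generates `G`.
(Biadditivity of `t`, `(x c) ⊙ y = x ⊙ (c y)` and `(x ⊙ y) b = x ⊙ (y b)` follow.) -/
structure IsInternalTensor {A C X Y G : Type*}
    [NormedAddCommGroup Y] [NormedSpace ℂ Y] [Module Bᵐᵒᵖ Y] [CStarModule Bᵐᵒᵖ Y]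
    [NormedAddCommGroup G] [NormedSpace ℂ G] [Module Bᵐᵒᵖ G] [CStarModule Bᵐᵒᵖ G]
    (lX : A → X → X) (ipX : X → X → C) (σ : C → Ba B Y) (τ : A → Ba B G)
    (t : X → Y → G) : Prop where
  left_linear : ∀ (a : A) (x : X) (y : Y), t (lX a x) y = (τ a).1 (t x y)
  inner_eq : ∀ (x : X) (y : Y) (x' : X) (y' : Y),
    ip B (t x y) (t x' y') = ip B y ((σ (ipX x x')).1 y')
  total : (Submodule.span ℂ (Set.range fun p : X × Y => t p.1 p.2)).topologicalClosure = ⊤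

variable {E : Type v} [NormedAddCommGroup E] [NormedSpace ℂ E] [Module Bᵐᵒᵖ E]
  [CStarModule Bᵐᵒᵖ E]
variable {F : Type w} [NormedAddCommGroup F] [NormedSpace ℂ F] [Module Bᵐᵒᵖ F]
  [CStarModule Bᵐᵒᵖ F]

/-- `F_ϑ = E`: the correspondence `E` over `B` with left action `π` is the correspondence
`F_ϑ = F* ⊙ _ϑF` of the endomorphism `ϑ` of `𝓑ᵃ(F)`.

`F* = {x* : x ∈ F}` is the dual correspondence from `B` to `𝓑ᵃ(F)`, whose element `x*` is
represented by `x`: its left action is `b x* = (x b*)*` and its inner product is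
`⟨x*, y*⟩ = x y*`.  `_ϑF` is `F` with the left action `a.x = ϑ(a) x` of `𝓑ᵃ(F)`. -/
def IsCorrespondenceOf (ϑ : Ba B F → Ba B F) (π : B → Ba B E) : Prop :=
  ∃ t : F → F → E, IsInternalTensor (fun (b : B) (x : F) => x <• star b)
    (fun x y : F => (rankOne x y : Ba B F)) ϑ π t

/-- `F = F ⊙ E` and `ϑ(a) = a ⊙ id_E`: the correspondence `_ϑF` from `𝓑ᵃ(F)` to `B` is the
internal tensor product of `F`, with its natural left action of `𝓑ᵃ(F)`, and `E`. -/
def IsAmplification (ϑ : Ba B F → Ba B F) (π : B → Ba B E) : Prop :=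
  ∃ t : F → E → F, IsInternalTensor (fun (a : Ba B F) (x : F) => a.1 x)
    (fun x y : F => ip B x y) π ϑ t

end Tensor

end HilbMod

set_option linter.unusedSectionVars false

/-! Fullness over a unital algebra gives finitely many `ξ j` in `E` with `∑ j, ⟨ξ j, ξ j⟩ = 1`
(`IsFull.exists_unit_system`). Let `H` be the Hilbert module with orthonormal basis `δ_w`, where `w`
runs over the words in the indices `j`. Then `V : δ_w ↦ ∑ j, δ_{jw} ⊙ ξ j` is an isometry from `H`
into `H ⊙ E`, and the inductive limit `F` of the modules `H ⊙ E^{⊙ n}` along `V ⊙ id` absorbs one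
more factor: `F ⊙ E ≅ F`. It is full because `⟨δ_[], δ_[]⟩ = 1`.

The limit is not formed level by level. Its inner products are prescribed as a kernel on pairs
(word, list of vectors), and `F` is the Hilbert module generated by that kernel. One identity,
`wordInner_eq_sum`, says that each generator has the inner products of `∑ j, wordInit s j ⊙ wordLast
s j`. Together with complete positivity (`sum_ip_nonneg`) it gives positivity of the kernel by
induction on the lists; it also gives the unitary `F ≅ F ⊙ E`.

Now put `ϑ(a) = a ⊙ id`. It is contractive (`IsTensorMap.norm_preAmp_le`), hence strict. With `L_x`
the adjoint of `e ↦ x ⊙ e`, the map `x* ⊙ y ↦ L_x y` identifies `F_ϑ` with `E`: inner products agree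
since `x' ⊙ L_x y = ϑ(x' x*) y`, and the range is total since `L_x (z ⊙ e) = ⟨x, z⟩ e` and `F` is
full. Conversely, inner products of elementary tensors in `F* ⊙ _ϑF` are inner products of vectors
of `F`, so fullness of `E` forces that of `F`. -/

namespace HilbMod

/-! ### Positive matrices over a C⋆-algebra. -/

section Positivity

variable {B : Type u} [CStarAlgebra B] [PartialOrder B] [StarOrderedRing B]

/-- A self-adjoint element `M` of a C⋆-algebra is compressed by its negative part to a negative
element, which vanishes only if `M` is positive. -/
theorem exists_negative_compression {A : Type*} [CStarAlgebra A] (M : A) (hM : IsSelfAdjoint M) :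
    ∃ N R S : A, star N = N ∧ N * M * N = -(star R * R) ∧ (R = 0 → M = star S * S) := by
  -- The spectral order is auxiliary; the conclusion mentions no order on `A`.
  let _ : PartialOrder A := CStarAlgebra.spectralOrder _
  have _ : StarOrderedRing A := CStarAlgebra.spectralOrderedRing _
  have hN0 : 0 ≤ M⁻ := CFC.negPart_nonneg M
  have hNs : star M⁻ = M⁻ := (IsSelfAdjoint.of_nonneg hN0).star_eq
  -- Since `M⁻ M⁺ = 0`, compression by `N = M⁻` gives `N M N = -N³`, and `N³ = R* R` for `R = √N N`.
  refine ⟨M⁻, CFC.sqrt M⁻ * M⁻, CFC.sqrt M, hNs, ?_, fun hR => ?_⟩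
  · have h1 : M = M⁺ - M⁻ := (CFC.posPart_sub_negPart M hM).symm
    have h2 : M⁻ * M⁺ = 0 := CFC.negPart_mul_posPart M
    have h3 : star (CFC.sqrt M⁻) = CFC.sqrt M⁻ :=
      (IsSelfAdjoint.of_nonneg (CFC.sqrt_nonneg _)).star_eq
    rw [star_mul, h3, hNs, mul_assoc M⁻ (CFC.sqrt M⁻), ← mul_assoc (CFC.sqrt M⁻),
      CFC.sqrt_mul_sqrt_self M⁻ hN0, ← mul_assoc]
    nth_rewrite 2 [h1]
    rw [mul_sub, h2, zero_sub, neg_mul]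
  · have h4 : M⁻ = 0 := by
      have h8 : star M⁻ * M⁻ = 0 := by
        rw [hNs]
        nth_rewrite 1 [← CFC.sqrt_mul_sqrt_self M⁻ hN0]
        rw [mul_assoc, hR, mul_zero]
      exact CStarRing.star_mul_self_eq_zero_iff _ |>.1 h8
    have hMpos : 0 ≤ M := (CFC.negPart_eq_zero_iff M hM).1 h4
    rw [(IsSelfAdjoint.of_nonneg (CFC.sqrt_nonneg M)).star_eq, CFC.sqrt_mul_sqrt_self M hMpos]

/-- A hermitian matrix over a C⋆-algebra whose quadratic form is positive is of the form `Q* Q`. -/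
theorem exists_matrix_factor {ι : Type*} [Fintype ι] [DecidableEq ι] (P : ι → ι → B)
    (hP : ∀ i j, star (P i j) = P j i)
    (hpos : ∀ b : ι → B, 0 ≤ ∑ i, ∑ j, star (b i) * P i j * b j) :
    ∃ Q : ι → ι → B, ∀ i j, P i j = ∑ k, star (Q k i) * Q k j := by
  let M : CStarMatrix ι ι B := CStarMatrix.ofMatrix (Matrix.of P)
  have hM : IsSelfAdjoint M := by
    ext i j
    exact hP j i
  obtain ⟨N, R, S, hNs, hNMN, hS⟩ := exists_negative_compression M hM
  -- The columns of `N`, used as coefficient vectors, make the diagonal of `N M N = -R* R`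
  -- nonnegative. So the diagonal entries `∑ i, R i k* R i k` vanish, and with them every entry of
  -- `R`.
  have hR : R = 0 := by
    ext i k
    have h6 : (star R * R) k k = 0 := by
      apply le_antisymm
      · have h4 := hpos (fun i => N i k)
        have h5 : (N * M * N) k k = ∑ i, ∑ j, star (N i k) * P i j * N j k := by
          simp only [CStarMatrix.mul_apply, Finset.sum_mul]
          rw [Finset.sum_comm]
          refine Finset.sum_congr rfl fun i _ => Finset.sum_congr rfl fun j _ => ?_
          have : star (N i k) = N k i := by
            conv_rhs => rw [← hNs]
            rfl
          rw [this]
          rfl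
        rw [← h5, hNMN] at h4
        simpa using h4
      · simp only [CStarMatrix.mul_apply]
        exact Finset.sum_nonneg fun i _ => star_mul_self_nonneg (R i k)
    simp only [CStarMatrix.mul_apply] at h6
    have h7 := (Finset.sum_eq_zero_iff_of_nonneg fun i _ => by
      exact star_mul_self_nonneg (R i k)).1 h6 i (Finset.mem_univ i)
    exact CStarRing.star_mul_self_eq_zero_iff _ |>.1 h7
  refine ⟨fun i j => S i j, fun i j => ?_⟩
  have h9 : M i j = (star S * S) i j := by rw [← hS hR]
  exact h9

end Positivity

/-! ### Further rules for the inner product. -/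

section Basic

variable {B : Type u} [CStarAlgebra B] [PartialOrder B] [StarOrderedRing B]
variable {E : Type v} [NormedAddCommGroup E] [NormedSpace ℂ E] [Module Bᵐᵒᵖ E]
  [CStarModule Bᵐᵒᵖ E]

theorem ip_add_left (x y z : E) : ip B (x + y) z = ip B x z + ip B y z := by
  simp [ip]

theorem ip_sub_left (x y z : E) : ip B (x - y) z = ip B x z - ip B y z := by
  simp [ip]

theorem ip_smul_left (c : ℂ) (x y : E) : ip B (c • x) y = star c • ip B x y := by
  simp [ip]

@[simp] theorem ip_zero_right (x : E) : ip B x 0 = 0 := by simp [ip]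

@[simp] theorem ip_zero_left (x : E) : ip B 0 x = 0 := by simp [ip]

theorem ip_sum_right {ι : Type*} (s : Finset ι) (x : E) (y : ι → E) :
    ip B x (∑ i ∈ s, y i) = ∑ i ∈ s, ip B x (y i) := by simp [ip]

theorem ip_sum_left {ι : Type*} (s : Finset ι) (x : ι → E) (y : E) :
    ip B (∑ i ∈ s, x i) y = ∑ i ∈ s, ip B (x i) y := by simp [ip]

theorem ip_self_nonneg (x : E) : 0 ≤ ip B x x :=
  MulOpposite.unop_nonneg.2 (CStarModule.inner_self_nonneg (A := Bᵐᵒᵖ))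

theorem continuous_ip : Continuous fun p : E × E => ip B p.1 p.2 :=
  MulOpposite.continuous_unop.comp (CStarModule.continuous_inner (A := Bᵐᵒᵖ))

theorem continuous_ip_right (x : E) : Continuous fun y : E => ip B x y :=
  continuous_ip.comp (Continuous.prodMk_right x)

theorem continuous_ip_left (y : E) : Continuous fun x : E => ip B x y :=
  continuous_ip.comp (Continuous.prodMk_left y)

end Basic

/-! ### The Hilbert module generated by a positive definite kernel. -/

section Kernel

variable (B : Type u) [CStarAlgebra B] [PartialOrder B] [StarOrderedRing B]

/-- A positive definite `B`-valued kernel on a set `S`. -/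
structure PosKernel (S : Type v) where
  toFun : S → S → B
  star_apply : ∀ s t, star (toFun s t) = toFun t s
  nonneg : ∀ (ι : Type) [Fintype ι] (p : ι → S) (b : ι → B),
    0 ≤ ∑ i, ∑ j, star (b i) * toFun (p i) (p j) * b j

end Kernel

section KernelModule

variable {B : Type u} [CStarAlgebra B] [PartialOrder B] [StarOrderedRing B] {S : Type v}

/-- Finite right linear combinations of points of `S`, with the semi-inner product of a kernel. -/
def KernelSpace (_K : PosKernel B S) : Type (max u v) := S →₀ B

variable (K : PosKernel B S)

noncomputable instance : AddCommGroup (KernelSpace K) := inferInstanceAs (AddCommGroup (S →₀ B))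
noncomputable instance : Module ℂ (KernelSpace K) := inferInstanceAs (Module ℂ (S →₀ B))
noncomputable instance : Module Bᵐᵒᵖ (KernelSpace K) := inferInstanceAs (Module Bᵐᵒᵖ (S →₀ B))

namespace KernelSpace

variable {K}

/-- The element `s b` of the kernel space. -/
noncomputable def single (s : S) (b : B) : KernelSpace K := Finsupp.single s b

/-- The semi-inner product of the kernel space. -/
noncomputable def form (x y : KernelSpace K) : B :=
  Finsupp.sum (M := B) x fun s b => Finsupp.sum (M := B) y fun t c => star b * K.toFun s t * c

theorem form_single (s t : S) (b c : B) :
    form (single s b : KernelSpace K) (single t c) = star b * K.toFun s t * c := by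
  unfold form single
  rw [Finsupp.sum_single_index, Finsupp.sum_single_index] <;> simp

theorem form_add_right (x y z : KernelSpace K) : form x (y + z) = form x y + form x z := by
  refine (Finset.sum_congr rfl fun s _ => ?_).trans Finset.sum_add_distrib
  exact Finsupp.sum_add_index' (by simp) (by simp [mul_add])

theorem star_form (x y : KernelSpace K) : star (form x y) = form y x := by
  unfold form
  simp only [Finsupp.sum, star_sum, star_mul, star_star, K.star_apply]
  rw [Finset.sum_comm]
  simp only [mul_assoc]

theorem form_mul_right (b : B) (x y : KernelSpace K) : form x (y <• b) = form x y * b := by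
  unfold form
  simp only [Finsupp.sum, Finset.sum_mul]
  refine Finset.sum_congr rfl fun s _ => ?_
  exact (Finsupp.sum_smul_index' (g := y) (b := MulOpposite.op b)
    (h := fun t c => star (DFunLike.coe (F := S →₀ B) x s) * K.toFun s t * c) (by simp)).trans
    (by simp [Finsupp.sum, mul_assoc])

theorem form_smul_right (c : ℂ) (x y : KernelSpace K) : form x (c • y) = c • form x y := by
  unfold form
  simp only [Finsupp.sum, Finset.smul_sum]
  refine Finset.sum_congr rfl fun s _ => ?_
  exact (Finsupp.sum_smul_index' (g := y) (b := c)
    (h := fun t d => star (DFunLike.coe (F := S →₀ B) x s) * K.toFun s t * d) (by simp)).trans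
    (by simp [Finsupp.sum])

theorem form_self_nonneg (x : KernelSpace K) : 0 ≤ form x x := by
  let f : S →₀ B := x
  -- Positivity of a kernel is stated for index types in `Type`, so the support is reindexed by
  -- `Fin`.
  let e := f.support.equivFin
  have h := K.nonneg (Fin f.support.card) (fun i => (e.symm i : S)) (fun i => f (e.symm i : S))
  have h1 : ∀ g : S → B, ∑ i, g (e.symm i : S) = ∑ s ∈ f.support, g s := fun g =>
    (e.symm.sum_comp fun s => g (s : S)).trans (Finset.sum_coe_sort f.support g)
  rw [h1 fun s => ∑ j, star (f s) * K.toFun s (e.symm j) * f (e.symm j)] at h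
  simp_rw [fun s => h1 fun t => star (f s) * K.toFun s t * f t] at h
  exact h

theorem form_add_left (x y z : KernelSpace K) : form (x + y) z = form x z + form y z := by
  rw [← star_form, form_add_right, star_add, star_form, star_form]

theorem form_mul_left (b : B) (x y : KernelSpace K) : form (x <• b) y = star b * form x y := by
  rw [← star_form, form_mul_right, star_mul, star_form]

theorem form_smul_left (c : ℂ) (x y : KernelSpace K) : form (c • x) y = star c • form x y := by
  rw [← star_form, form_smul_right, star_smul, star_form]

/-- Cauchy–Schwarz: with `a = ⟨x, y⟩` and `c ≥ ‖⟨x, x⟩‖`, expanding `0 ≤ ⟨x a - c y, x a - c y⟩`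
gives `c a* a ≤ c² ⟨y, y⟩`. Cancelling needs `c > 0`, while `⟨x, x⟩` may vanish; hence the limit `c
↓ ‖⟨x, x⟩‖` at the end. -/
theorem norm_form_sq_le (x y : KernelSpace K) :
    ‖form x y‖ ^ 2 ≤ ‖form x x‖ * ‖form y y‖ := by
  have key : ∀ c : ℝ, 0 < c → ‖form x x‖ ≤ c → ‖form x y‖ ^ 2 ≤ c * ‖form y y‖ := by
    intro c hc hx
    set a := form x y with ha
    have hyx : form y x = star a := by rw [ha, star_form]
    have h1 := form_self_nonneg (x <• a + (-(c : ℂ)) • y)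
    have h2 : form (x <• a + (-(c : ℂ)) • y) (x <• a + (-(c : ℂ)) • y) =
        star a * form x x * a - (c : ℂ) • (star a * a) - (c : ℂ) • (star a * a)
          + (c : ℂ) • ((c : ℂ) • form y y) := by
      simp only [form_add_left, form_add_right, form_mul_left, form_mul_right, form_smul_left,
        form_smul_right, hyx, ← ha, star_neg, Complex.star_def, Complex.conj_ofReal]
      simp only [neg_smul, smul_neg, neg_neg, add_mul, neg_mul, smul_mul_assoc, mul_assoc, smul_add]
      abel
    have h3 : star a * form x x * a ≤ ‖form x x‖ • (star a * a) :=
      CStarAlgebra.star_left_conjugate_le_norm_smul (hb := (star_form x x : IsSelfAdjoint _))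
    have h4 : ‖form x x‖ • (star a * a) ≤ c • (star a * a) :=
      smul_le_smul_of_nonneg_right hx (star_mul_self_nonneg a)
    rw [h2] at h1
    simp only [Complex.coe_smul] at h1
    have h5 : 0 ≤ c • (c • form y y - star a * a) := by
      rw [smul_sub]
      calc (0 : B) ≤ _ := h1
        _ ≤ c • (star a * a) - c • (star a * a) - c • (star a * a) + c • (c • form y y) := by
          gcongr
          exact h3.trans h4
        _ = _ := by abel
    have h6 : star a * a ≤ c • form y y := by
      rw [← sub_nonneg]
      have := smul_nonneg (inv_nonneg.2 hc.le) h5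
      rwa [smul_smul, inv_mul_cancel₀ hc.ne', one_smul] at this
    calc ‖a‖ ^ 2 = ‖star a * a‖ := by rw [CStarRing.norm_star_mul_self, sq]
      _ ≤ ‖c • form y y‖ := CStarAlgebra.norm_le_norm_of_nonneg_of_le (star_mul_self_nonneg a) h6
      _ = c * ‖form y y‖ := by rw [norm_smul, Real.norm_of_nonneg hc.le]
  refine le_of_forall_pos_le_add fun δ hδ => ?_
  have hm : 0 < ‖form y y‖ + 1 := by positivity
  refine (key (‖form x x‖ + δ / (‖form y y‖ + 1)) (by positivity)
    (by linarith [div_pos hδ hm])).trans ?_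
  rw [add_mul]
  gcongr
  rw [div_mul_eq_mul_div, div_le_iff₀ hm]
  nlinarith [norm_nonneg (form y y)]

variable (K) in
noncomputable instance : Norm (KernelSpace K) := ⟨fun x => √‖form x x‖⟩

theorem norm_def (x : KernelSpace K) : ‖x‖ = √‖form x x‖ := rfl

theorem norm_sq (x : KernelSpace K) : ‖x‖ ^ 2 = ‖form x x‖ := Real.sq_sqrt (norm_nonneg _)

theorem norm_form_le (x y : KernelSpace K) : ‖form x y‖ ≤ ‖x‖ * ‖y‖ := by
  rw [norm_def, norm_def, ← Real.sqrt_mul (norm_nonneg _)]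
  exact Real.le_sqrt_of_sq_le (norm_form_sq_le x y)

variable (K) in
theorem seminormedSpaceCore : SeminormedSpace.Core ℂ (KernelSpace K) where
  norm_nonneg x := Real.sqrt_nonneg _
  norm_smul c x := by
    rw [norm_def, form_smul_left, form_smul_right, norm_smul, norm_smul, norm_star, ← mul_assoc,
      Real.sqrt_mul (by positivity), Real.sqrt_mul_self (norm_nonneg c), norm_def]
  norm_triangle x y := by
    have hx : 0 ≤ ‖x‖ := Real.sqrt_nonneg _
    have hy : 0 ≤ ‖y‖ := Real.sqrt_nonneg _
    refine le_of_sq_le_sq ?_ (by positivity)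
    rw [norm_sq, form_add_left, form_add_right, form_add_right]
    calc _ ≤ ‖form x x‖ + ‖form x y‖ + (‖form y x‖ + ‖form y y‖) :=
          (norm_add_le _ _).trans (add_le_add (norm_add_le _ _) (norm_add_le _ _))
      _ ≤ ‖x‖ ^ 2 + ‖x‖ * ‖y‖ + (‖y‖ * ‖x‖ + ‖y‖ ^ 2) := by
          rw [norm_sq, norm_sq]
          gcongr <;> exact norm_form_le _ _
      _ = _ := by ring

variable (K) in
noncomputable instance : SeminormedAddCommGroup (KernelSpace K) :=
  SeminormedAddCommGroup.ofCore (seminormedSpaceCore K)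

variable (K) in
noncomputable instance : NormedSpace ℂ (KernelSpace K) where
  norm_smul_le c x := ((seminormedSpaceCore K).norm_smul c x).le

theorem norm_rmul_le (x : KernelSpace K) (b : B) : ‖x <• b‖ ≤ ‖b‖ * ‖x‖ := by
  refine le_of_sq_le_sq ?_ (by positivity)
  rw [norm_sq, form_mul_right, form_mul_left, mul_pow, norm_sq]
  calc ‖star b * form x x * b‖ ≤ ‖star b‖ * ‖form x x‖ * ‖b‖ :=
        (norm_mul_le _ _).trans (by gcongr; exact norm_mul_le _ _)
    _ = ‖b‖ ^ 2 * ‖form x x‖ := by rw [norm_star]; ring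

-- This lets the right action of `B` extend to the completion.
variable (K) in
instance : UniformContinuousConstSMul Bᵐᵒᵖ (KernelSpace K) where
  uniformContinuous_const_smul b := by
    refine (AddMonoidHomClass.lipschitz_of_bound (DistribSMul.toAddMonoidHom (KernelSpace K) b)
      ‖b‖ fun x => ?_).uniformContinuous
    exact norm_rmul_le x b.unop

theorem continuous_form : Continuous fun p : KernelSpace K × KernelSpace K => form p.1 p.2 := by
  let f : KernelSpace K →ₗ⋆[ℂ] KernelSpace K →ₗ[ℂ] B :=
    { toFun := fun x =>
        { toFun := fun y => form x y
          map_add' := form_add_right x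
          map_smul' := fun c y => form_smul_right c x y }
      map_add' := fun x y => by ext z; exact form_add_left x y z
      map_smul' := fun c x => by ext z; exact form_smul_left c x z }
  let F := LinearMap.mkContinuous₂ f 1 fun x y => by
    rw [one_mul]
    exact norm_form_le x y
  change Continuous fun p : KernelSpace K × KernelSpace K => F p.1 p.2
  fun_prop

end KernelSpace

open UniformSpace

/-- The Hilbert module generated by a set `S` with inner products given by a positive definite
kernel. -/
abbrev KernelModule : Type (max u v) := Completion (KernelSpace K)

namespace KernelModule

open Function

/-- The inner product of the kernel module. -/
noncomputable def inner' : KernelModule K → KernelModule K → B :=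
  curry <| (Completion.isDenseInducing_coe.prodMap Completion.isDenseInducing_coe).extend
    (uncurry (KernelSpace.form (K := K)))

variable {K}

theorem inner'_coe (x y : KernelSpace K) :
    inner' K (x : KernelModule K) (y : KernelModule K) = KernelSpace.form x y :=
  (Completion.isDenseInducing_coe.prodMap Completion.isDenseInducing_coe).extend_eq
    KernelSpace.continuous_form (x, y)

theorem continuous_inner' : Continuous fun p : KernelModule K × KernelModule K =>
    inner' K p.1 p.2 := by
  let f : KernelSpace K →+ KernelSpace K →+ B :=
    { toFun := fun x =>
        { toFun := fun y => KernelSpace.form x y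
          map_zero' := by simpa using KernelSpace.form_smul_right 0 x 0
          map_add' := KernelSpace.form_add_right x }
      map_zero' := by ext y; simpa using KernelSpace.form_smul_left 0 0 y
      map_add' := fun x y => by ext z; exact KernelSpace.form_add_left x y z }
  have h : Continuous fun p : KernelSpace K × KernelSpace K => f p.1 p.2 :=
    KernelSpace.continuous_form
  exact (Completion.isDenseInducing_toCompl (KernelSpace K)).extend_Z_bilin
    (Completion.isDenseInducing_toCompl (KernelSpace K)) h

theorem continuous_inner'_comp {X : Type*} [TopologicalSpace X] {f g : X → KernelModule K}
    (hf : Continuous f) (hg : Continuous g) : Continuous fun x => inner' K (f x) (g x) :=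
  continuous_inner'.comp (hf.prodMk hg)

theorem norm_sq_eq_inner' (x : KernelModule K) : ‖x‖ ^ 2 = ‖inner' K x x‖ := by
  induction x using Completion.induction_on with
  | hp => exact isClosed_eq (by fun_prop) (continuous_inner'_comp continuous_id continuous_id).norm
  | ih x => rw [inner'_coe, Completion.norm_coe, KernelSpace.norm_sq]

noncomputable instance : CStarModule Bᵐᵒᵖ (KernelModule K) where
  inner x y := MulOpposite.op (inner' K x y)
  inner_add_right {x y z} := by
    rw [← MulOpposite.op_add]
    congr 1
    induction x, y, z using Completion.induction_on₃ with
    | hp =>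
      exact isClosed_eq (continuous_inner'_comp (by fun_prop) (by fun_prop))
        ((continuous_inner'_comp (by fun_prop) (by fun_prop)).add
          (continuous_inner'_comp (by fun_prop) (by fun_prop)))
    | ih x y z =>
      rw [← Completion.coe_add]
      simp only [inner'_coe, KernelSpace.form_add_right]
  inner_self_nonneg {x} := by
    rw [MulOpposite.op_nonneg]
    induction x using Completion.induction_on with
    | hp => exact isClosed_le continuous_const (continuous_inner'_comp continuous_id continuous_id)
    | ih x => rw [inner'_coe]; exact KernelSpace.form_self_nonneg x
  -- The completion is separated, so null vectors of the form have become zero.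
  inner_self {x} := by
    rw [MulOpposite.op_eq_zero_iff, ← norm_eq_zero, ← norm_sq_eq_inner', sq_eq_zero_iff,
      norm_eq_zero]
  inner_op_smul_right {a x y} := by
    rw [← MulOpposite.op_unop a, ← MulOpposite.op_mul]
    congr 1
    induction x, y using Completion.induction_on₂ with
    | hp =>
      exact isClosed_eq
        (continuous_inner'_comp continuous_fst ((continuous_const_smul _).comp continuous_snd))
        ((continuous_inner'_comp continuous_fst continuous_snd).mul continuous_const)
    | ih x y =>
      rw [← Completion.coe_smul]
      simp only [inner'_coe, KernelSpace.form_mul_right]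
  inner_smul_right_complex {c x y} := by
    rw [← MulOpposite.op_smul]
    congr 1
    induction x, y using Completion.induction_on₂ with
    | hp =>
      exact isClosed_eq
        (continuous_inner'_comp continuous_fst ((continuous_const_smul _).comp continuous_snd))
        ((continuous_inner'_comp continuous_fst continuous_snd).const_smul _)
    | ih x y =>
      rw [← Completion.coe_smul]
      simp only [inner'_coe, KernelSpace.form_smul_right]
  star_inner x y := by
    rw [← MulOpposite.op_star]
    congr 1
    induction x, y using Completion.induction_on₂ with
    | hp =>
      exact isClosed_eq (continuous_inner'_comp continuous_fst continuous_snd).star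
        (continuous_inner'_comp continuous_snd continuous_fst)
    | ih x y => simp only [inner'_coe, KernelSpace.star_form]
  norm_eq_sqrt_norm_inner_self x := by
    rw [MulOpposite.norm_op, ← norm_sq_eq_inner', Real.sqrt_sq (norm_nonneg x)]

/-- The canonical map from `S` into the kernel module. -/
noncomputable def point (s : S) : KernelModule K := (KernelSpace.single s 1 : KernelSpace K)

theorem ip_point (s t : S) : ip B (point s : KernelModule K) (point t) = K.toFun s t :=
  (inner'_coe _ _).trans (by simp [KernelSpace.form_single])

theorem point_rmul (s : S) (b : B) :
    (point s : KernelModule K) <• b = ((KernelSpace.single s b : KernelSpace K) :) := by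
  rw [point, ← Completion.coe_smul]
  congr 1
  exact (Finsupp.smul_single _ _ _).trans (by simp [KernelSpace.single])

end KernelModule

end KernelModule

/-! ### Total families and the unitaries between them. -/

section Total

variable {B : Type u} [CStarAlgebra B] [PartialOrder B] [StarOrderedRing B]
variable {E : Type v} [NormedAddCommGroup E] [NormedSpace ℂ E] [Module Bᵐᵒᵖ E]
  [CStarModule Bᵐᵒᵖ E]
variable {F : Type w} [NormedAddCommGroup F] [NormedSpace ℂ F] [Module Bᵐᵒᵖ F]
  [CStarModule Bᵐᵒᵖ F]

/-- A family is total if its linear span is dense. -/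
def IsTotal {I G : Type*} [NormedAddCommGroup G] [NormedSpace ℂ G] (g : I → G) : Prop :=
  (Submodule.span ℂ (Set.range g)).topologicalClosure = ⊤

theorem IsTotal.denseRange {I : Type*} {g : I → E} (hg : IsTotal g) :
    DenseRange (Finsupp.linearCombination ℂ g) := by
  have h : Set.range (Finsupp.linearCombination ℂ g) =
      (Submodule.span ℂ (Set.range g) : Set E) := by
    rw [← Finsupp.range_linearCombination]
    rfl
  rw [DenseRange, h]
  exact (Submodule.dense_iff_topologicalClosure_eq_top).2 hg

theorem IsTotal.mem {I : Type*} {g : I → E} (hg : IsTotal g) {M : Submodule ℂ E}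
    (hM : IsClosed (M : Set E)) (h : ∀ i, g i ∈ M) (x : E) : x ∈ M := by
  have h1 := Submodule.topologicalClosure_minimal (Submodule.span ℂ (Set.range g))
    (Submodule.span_le.2 (Set.range_subset_iff.2 h)) hM
  rw [show (Submodule.span ℂ (Set.range g)).topologicalClosure = ⊤ from hg] at h1
  exact h1 trivial

theorem IsTotal.of_mem {I J : Type*} {g : I → E} (hg : IsTotal g) {h : J → E}
    (hh : ∀ i, g i ∈ (Submodule.span ℂ (Set.range h)).topologicalClosure) : IsTotal h :=
  eq_top_iff.2 fun x _ => hg.mem (Submodule.isClosed_topologicalClosure _) hh x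

theorem IsTotal.ext_ip {I : Type*} {g : I → E} (hg : IsTotal g) {x y : E}
    (h : ∀ i, ip B (g i) x = ip B (g i) y) : x = y := by
  refine HilbMod.ext_ip (B := B) fun z => ?_
  exact hg.mem (M :=
    { carrier := {z | ip B z x = ip B z y}
      add_mem' := fun {a b} ha hb => by
        change ip B (a + b) x = ip B (a + b) y
        rw [ip_add_left, ip_add_left, ha, hb]
      zero_mem' := by simp
      smul_mem' := fun c a ha => by
        change ip B (c • a) x = ip B (c • a) y
        rw [ip_smul_left, ip_smul_left, ha] })
    (isClosed_eq (continuous_ip_left x) (continuous_ip_left y)) h z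

theorem IsTotal.clm_ext {I : Type*} {g : I → E} (hg : IsTotal g) {a b : E →L[ℂ] F}
    (h : ∀ i, a (g i) = b (g i)) : a = b := by
  ext x
  exact hg.mem (M := LinearMap.eqLocus (a : E →ₗ[ℂ] F) (b : E →ₗ[ℂ] F))
    (isClosed_eq a.continuous b.continuous) h x

theorem ip_linearCombination {I : Type*} {g g' : I → E} {h h' : I → F}
    (hgh : ∀ i j, ip B (g i) (g' j) = ip B (h i) (h' j)) (v w : I →₀ ℂ) :
    ip B (Finsupp.linearCombination ℂ g v) (Finsupp.linearCombination ℂ g' w) =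
      ip B (Finsupp.linearCombination ℂ h v) (Finsupp.linearCombination ℂ h' w) := by
  simp only [Finsupp.linearCombination_apply, Finsupp.sum, ip_sum_left, ip_sum_right,
    ip_smul_left, ip_smul_right, hgh]

/-- Total families with the same inner products are intertwined by a unitary. -/
theorem exists_unitary [CompleteSpace E] [CompleteSpace F] {I : Type*} {g : I → E} {h : I → F}
    (hg : IsTotal g) (hh : IsTotal h) (hgh : ∀ i j, ip B (g i) (g j) = ip B (h i) (h j)) :
    ∃ U : E ≃L[ℂ] F, (∀ i, U (g i) = h i) ∧ ∀ x y, ip B (U x) (U y) = ip B x y := by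
  have hn : ∀ v, ‖Finsupp.linearCombination ℂ h v‖ = ‖Finsupp.linearCombination ℂ g v‖ := by
    intro v
    refine (pow_left_inj₀ (norm_nonneg _) (norm_nonneg _) two_ne_zero).1 ?_
    rw [norm_sq_eq (B := B), norm_sq_eq (B := B), ip_linearCombination hgh]
  -- The identity on coefficient families descends to an isometry between the two dense spans.
  let U : E ≃L[ℂ] F := (LinearEquiv.refl ℂ (I →₀ ℂ)).extend
    (Finsupp.linearCombination ℂ g) (Finsupp.linearCombination ℂ h) hg.denseRange
    ⟨1, fun v => by simpa using (hn v).le⟩ hh.denseRange ⟨1, fun v => by simpa using (hn v).ge⟩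
  have hU : ∀ v, U (Finsupp.linearCombination ℂ g v) = Finsupp.linearCombination ℂ h v :=
    fun v => LinearEquiv.extend_eq ..
  refine ⟨U, fun i => ?_, fun x y => ?_⟩
  · simpa using hU (Finsupp.single i 1)
  · refine DenseRange.induction_on₂
      (p := fun x y => ip B (U x) (U y) = ip B x y) hg.denseRange ?_ ?_ x y
    · have hc : Continuous fun p : E × E => ip B (U p.1) (U p.2) :=
        continuous_ip.comp (f := fun p : E × E => (U p.1, U p.2)) (by fun_prop)
      exact isClosed_eq hc continuous_ip
    · intro v w
      rw [hU, hU, ip_linearCombination hgh]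

theorem KernelModule.isTotal {S : Type v} (K : PosKernel B S) :
    IsTotal fun p : S × B => (KernelModule.point p.1 : KernelModule K) <• p.2 := by
  refine Submodule.eq_top_iff'.2 fun x => ?_
  induction x using UniformSpace.Completion.induction_on with
  | hp =>
    exact Submodule.isClosed_topologicalClosure (Submodule.span ℂ (Set.range fun p : S × B =>
      (KernelModule.point p.1 : KernelModule K) <• p.2))
  | ih x =>
    apply Submodule.le_topologicalClosure
    refine Finsupp.induction_linear
      (motive := fun x : S →₀ B => ((show KernelSpace K from x : KernelSpace K) : KernelModule K) ∈
        Submodule.span ℂ (Set.range fun p : S × B =>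
          (KernelModule.point p.1 : KernelModule K) <• p.2)) x ?_ ?_ ?_
    · exact (UniformSpace.Completion.coe_zero (α := KernelSpace K)) ▸ Submodule.zero_mem _
    · intro f g hf hg
      exact (UniformSpace.Completion.coe_add (α := KernelSpace K) f g) ▸ Submodule.add_mem _ hf hg
    · intro s b
      refine Submodule.subset_span ⟨(s, b), ?_⟩
      exact KernelModule.point_rmul s b

end Total

/-! ### Complete positivity and the internal tensor product. -/

section TensorProduct

variable {B : Type u} [CStarAlgebra B] [PartialOrder B] [StarOrderedRing B]
variable {E : Type v} [NormedAddCommGroup E] [NormedSpace ℂ E] [Module Bᵐᵒᵖ E]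
  [CStarModule Bᵐᵒᵖ E]
variable {F : Type w} [NormedAddCommGroup F] [NormedSpace ℂ F] [Module Bᵐᵒᵖ F]
  [CStarModule Bᵐᵒᵖ F]

theorem ip_apply_left (a : Ba B E) (x y : E) : ip B (a.1 x) y = ip B x ((star a : Ba B E).1 y) :=
  (ip_star_right a x y).symm

theorem ip_apply_right (a : Ba B E) (x y : E) :
    ip B x (a.1 y) = ip B ((star a : Ba B E).1 x) y := by
  rw [ip_apply_left, star_star]

theorem ba_rmul (a : Ba B E) (x : E) (b : B) : a.1 (x <• b) = a.1 x <• b :=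
  ext_ip (B := B) fun z => by
    rw [ip_apply_right, ip_mul_right, ip_mul_right, ip_apply_right]

@[simp] theorem ba_mul_apply (a b : Ba B E) (x : E) : (a * b).1 x = a.1 (b.1 x) := rfl

@[simp] theorem ba_add_apply (a b : Ba B E) (x : E) : (a + b).1 x = a.1 x + b.1 x := rfl

@[simp] theorem ba_smul_apply (c : ℂ) (a : Ba B E) (x : E) : (c • a).1 x = c • a.1 x := rfl

@[simp] theorem ba_one_apply (x : E) : (1 : Ba B E).1 x = x := rfl

@[simp] theorem ba_zero_apply (x : E) : (0 : Ba B E).1 x = 0 := rfl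

theorem ba_sum_apply {ι : Type*} (s : Finset ι) (a : ι → Ba B E) (x : E) :
    (∑ i ∈ s, a i).1 x = ∑ i ∈ s, (a i).1 x := by
  simp

/-- Complete positivity of a representation by adjointable operators. -/
theorem sum_ip_nonneg (π : B →⋆ₙₐ[ℂ] Ba B E) {ι : Type*} [Fintype ι] (P : ι → ι → B)
    (hP : ∀ i j, star (P i j) = P j i)
    (hpos : ∀ b : ι → B, 0 ≤ ∑ i, ∑ j, star (b i) * P i j * b j) (e : ι → E) :
    0 ≤ ∑ i, ∑ j, ip B (e i) ((π (P i j)).1 (e j)) := by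
  classical
  obtain ⟨Q, hQ⟩ := exists_matrix_factor P hP hpos
  -- With `P = Q* Q` the double sum is `∑ k, ⟨v k, v k⟩` for `v k = ∑ i, π(Q k i) (e i)`.
  have h : ∑ i, ∑ j, ip B (e i) ((π (P i j)).1 (e j)) =
      ∑ k, ip B (∑ i, (π (Q k i)).1 (e i)) (∑ i, (π (Q k i)).1 (e i)) := by
    simp only [ip_sum_left, ip_sum_right, hQ, map_sum, map_mul, map_star, ba_sum_apply,
      ba_mul_apply, ip_star_right]
    rw [Finset.sum_comm' (t' := Finset.univ) (s' := fun _ => Finset.univ) (by simp)]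
    rw [Finset.sum_comm]
    refine (Finset.sum_congr rfl fun i _ => Finset.sum_comm).trans ?_
    rw [Finset.sum_comm]
    exact Finset.sum_congr rfl fun k _ => Finset.sum_comm
  rw [h]
  exact Finset.sum_nonneg fun k _ => ip_self_nonneg _

/-- `t` has the inner products of the elementary tensors of `F ⊙ E`. -/
def IsTensorMap {G : Type*} [NormedAddCommGroup G] [NormedSpace ℂ G] [Module Bᵐᵒᵖ G]
    [CStarModule Bᵐᵒᵖ G] (π : B →⋆ₙₐ[ℂ] Ba B E) (t : F → E → G) : Prop :=
  ∀ x y x' y', ip B (t x y) (t x' y') = ip B y ((π (ip B x x')).1 y')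

theorem star_ip_apply (π : B →⋆ₙₐ[ℂ] Ba B E) (b : B) (x y : E) :
    star (ip B x ((π b).1 y)) = ip B y ((π (star b)).1 x) := by
  rw [star_ip, map_star, ip_star_right]

variable (F) in
/-- The kernel of the internal tensor product `F ⊙ E`. -/
noncomputable def tensorKernel (π : B →⋆ₙₐ[ℂ] Ba B E) : PosKernel B (F × E) where
  toFun p q := ip B p.2 ((π (ip B p.1 q.1)).1 q.2)
  star_apply p q := by rw [star_ip_apply, star_ip]
  nonneg ι _ p b := by
    have h := sum_ip_nonneg π (fun i j => ip B (p i).1 (p j).1) (fun i j => star_ip _ _)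
      (fun c => by
        have h1 := ip_self_nonneg (B := B) (∑ i, (p i).1 <• c i)
        simp only [ip_sum_left, ip_sum_right, ip_mul_left, ip_mul_right] at h1
        simp only [Finset.sum_mul] at h1
        rwa [Finset.sum_comm] at h1) (fun i => (p i).2 <• b i)
    simpa only [ba_rmul, ip_mul_left, ip_mul_right, mul_assoc] using h

/-- The elementary tensors of the kernel module of `F ⊙ E`. -/
noncomputable def tmul (π : B →⋆ₙₐ[ℂ] Ba B E) (x : F) (y : E) : KernelModule (tensorKernel F π) :=
  KernelModule.point (x, y)

theorem isTensorMap_tmul (π : B →⋆ₙₐ[ℂ] Ba B E) :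
    IsTensorMap π (tmul π : F → E → KernelModule (tensorKernel F π)) :=
  fun _ _ _ _ => KernelModule.ip_point _ _

/-- Representations of `B` by adjointable operators are contractive. -/
theorem norm_rep_apply_le {π : B →⋆ₙₐ[ℂ] Ba B E} (hπ : π 1 = 1) (b : B) (y : E) :
    ‖(π b).1 y‖ ≤ ‖b‖ * ‖y‖ := by
  have h1 : star b * b ≤ algebraMap ℝ B (‖b‖ ^ 2) := by
    rw [sq, ← CStarRing.norm_star_mul_self]
    exact (IsSelfAdjoint.star_mul_self b).le_algebraMap_norm_self
  -- Writing `‖b‖² - b* b = c* c` and applying `π` yields `0 ≤ ⟨π(c) y, π(c) y⟩ = ‖b‖² ⟨y, y⟩ -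
  -- ⟨π(b) y, π(b) y⟩`.
  obtain ⟨c, hc⟩ := CStarAlgebra.nonneg_iff_eq_star_mul_self.1 (sub_nonneg.2 h1)
  have h2 : ip B ((π b).1 y) ((π b).1 y) ≤ (‖b‖ ^ 2) • ip B y y := by
    rw [← sub_nonneg]
    have h3 := ip_self_nonneg (B := B) ((π c).1 y)
    have h4 : ip B ((π c).1 y) ((π c).1 y) = ip B y ((π (star c * c)).1 y) := by
      rw [map_mul, map_star, ba_mul_apply, ip_star_right]
    rw [h4, ← hc] at h3
    have h5 : algebraMap ℝ B (‖b‖ ^ 2) = ((‖b‖ ^ 2 : ℝ) : ℂ) • (1 : B) := by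
      rw [Algebra.algebraMap_eq_smul_one, Complex.coe_smul]
    have h6 : (π (algebraMap ℝ B (‖b‖ ^ 2) - star b * b)).1 y =
        ((‖b‖ ^ 2 : ℝ) : ℂ) • y - (star (π b)).1 ((π b).1 y) := by
      rw [h5, map_sub, map_smul, hπ, map_mul, map_star]
      rfl
    rw [h6, ip_sub_right, ip_star_right, ip_smul_right, Complex.coe_smul] at h3
    exact h3
  refine le_of_sq_le_sq ?_ (by positivity)
  rw [norm_sq_eq (B := B), mul_pow, norm_sq_eq (B := B) y]
  refine (CStarAlgebra.norm_le_norm_of_nonneg_of_le (ip_self_nonneg _) h2).trans ?_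
  rw [norm_smul, Real.norm_of_nonneg (by positivity)]

/-- A nondegenerate representation of a unital algebra is unital. -/
theorem map_one_of_nondegenerate {π : B →⋆ₙₐ[ℂ] Ba B E} (hπ : IsNondegenerate π) : π 1 = 1 := by
  apply Subtype.ext
  refine IsTotal.clm_ext (g := fun p : B × E => (π p.1).1 p.2) hπ fun p => ?_
  change (π 1 * π p.1).1 p.2 = (π p.1).1 p.2
  rw [← map_mul, one_mul]

section TensorMap

variable {G : Type*} [NormedAddCommGroup G] [NormedSpace ℂ G] [Module Bᵐᵒᵖ G] [CStarModule Bᵐᵒᵖ G]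
variable {π : B →⋆ₙₐ[ℂ] Ba B E} {t : F → E → G}

/-- All algebraic rules for `⊙` below come from this: expanding `⟨x - y, x - y⟩` involves only the
prescribed inner products, and the terms cancel. -/
theorem eq_of_ip_sub {x y : E} (h : ip B (x - y) (x - y) = 0) : x = y :=
  sub_eq_zero.1 ((ip_self_eq_zero _).1 h)

theorem IsTensorMap.add_left (ht : IsTensorMap π t) (x x' : F) (y : E) :
    t (x + x') y = t x y + t x' y := by
  apply eq_of_ip_sub (B := B)
  simp only [ip_sub_left, ip_sub_right, ip_add_left, ip_add_right, ht _ _ _ _, map_add,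
    ba_add_apply]
  abel

theorem IsTensorMap.smul_left (ht : IsTensorMap π t) (c : ℂ) (x : F) (y : E) :
    t (c • x) y = c • t x y := by
  apply eq_of_ip_sub (B := B)
  simp only [ip_sub_left, ip_sub_right, ip_smul_left, ip_smul_right, ht _ _ _ _, map_smul,
    ba_smul_apply, smul_comm c (star c)]
  simp

theorem IsTensorMap.add_right (ht : IsTensorMap π t) (x : F) (y y' : E) :
    t x (y + y') = t x y + t x y' := by
  apply eq_of_ip_sub (B := B)
  simp only [ip_sub_left, ip_sub_right, ip_add_left, ip_add_right, ht _ _ _ _, map_add]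
  abel

theorem IsTensorMap.smul_right (ht : IsTensorMap π t) (c : ℂ) (x : F) (y : E) :
    t x (c • y) = c • t x y := by
  apply eq_of_ip_sub (B := B)
  simp only [ip_sub_left, ip_sub_right, ip_smul_left, ip_smul_right, ht _ _ _ _, map_smul,
    smul_comm c (star c)]
  simp

theorem IsTensorMap.rmul_left (ht : IsTensorMap π t) (x : F) (b : B) (y : E) :
    t (x <• b) y = t x ((π b).1 y) := by
  apply eq_of_ip_sub (B := B)
  simp only [ip_sub_left, ip_sub_right, ip_mul_left, ip_mul_right, ht _ _ _ _, map_mul, map_star,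
    ba_mul_apply, ip_star_right]
  simp

theorem IsTensorMap.rmul_right (ht : IsTensorMap π t) (x : F) (y : E) (b : B) :
    t x (y <• b) = t x y <• b := by
  apply eq_of_ip_sub (B := B)
  simp only [ip_sub_left, ip_sub_right, ip_mul_left, ip_mul_right, ht _ _ _ _, ba_rmul,
    mul_assoc]
  simp

theorem IsTensorMap.norm_le (ht : IsTensorMap π t) (hπ : π 1 = 1) (x : F) (y : E) :
    ‖t x y‖ ≤ ‖x‖ * ‖y‖ := by
  refine le_of_sq_le_sq ?_ (by positivity)
  rw [norm_sq_eq (B := B), ht, mul_pow, norm_sq_eq (B := B) x]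
  calc _ ≤ ‖y‖ * (‖ip B x x‖ * ‖y‖) := (norm_ip_le _ _).trans (by
        gcongr
        exact norm_rep_apply_le hπ _ _)
    _ = _ := by ring

/-- `x ↦ x ⊙ y` as a bounded operator. -/
noncomputable def IsTensorMap.leftCLM (ht : IsTensorMap π t) (hπ : π 1 = 1) (y : E) : F →L[ℂ] G :=
  LinearMap.mkContinuous
    { toFun := fun x => t x y
      map_add' := fun x x' => ht.add_left x x' y
      map_smul' := fun c x => ht.smul_left c x y } ‖y‖
    fun x => (ht.norm_le hπ x y).trans (mul_comm _ _).le

@[simp] theorem IsTensorMap.leftCLM_apply (ht : IsTensorMap π t) (hπ : π 1 = 1) (x : F) (y : E) :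
    ht.leftCLM hπ y x = t x y := rfl

/-- `y ↦ x ⊙ y` as a bounded operator. -/
noncomputable def IsTensorMap.rightCLM (ht : IsTensorMap π t) (hπ : π 1 = 1) (x : F) : E →L[ℂ] G :=
  LinearMap.mkContinuous
    { toFun := fun y => t x y
      map_add' := fun y y' => ht.add_right x y y'
      map_smul' := fun c y => ht.smul_right c x y } ‖x‖
    fun y => ht.norm_le hπ x y

@[simp] theorem IsTensorMap.rightCLM_apply (ht : IsTensorMap π t) (hπ : π 1 = 1) (x : F) (y : E) :
    ht.rightCLM hπ x y = t x y := rfl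

end TensorMap

end TensorProduct

/-! ### The inductive limit of the modules `B^∞ ⊙ E^{⊙ n}`. -/

section WordKernel

variable {B : Type u} [CStarAlgebra B] [PartialOrder B] [StarOrderedRing B]
variable {E : Type v} [NormedAddCommGroup E] [NormedSpace ℂ E] [Module Bᵐᵒᵖ E]
  [CStarModule Bᵐᵒᵖ E]
variable (π : B →⋆ₙₐ[ℂ] Ba B E) {m : ℕ} (ξ : Fin (m + 1) → E)

/-- The inner products of the vectors `δ_w ⊙ e₁ ⊙ … ⊙ eₙ`, encoded by the word `w` and the list
`[eₙ, …, e₁]`, in the inductive limit of the modules `B^∞ ⊙ E^{⊙ n}` under the embeddings induced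
by `δ_w ↦ ∑ j, δ_{j w} ⊙ ξ j`. -/
noncomputable def wordInner : List (Fin (m + 1)) → List E → List (Fin (m + 1)) → List E → B
  | w, [], w', [] => if w = w' then 1 else 0
  | w, [], w', e' :: l' => ∑ j, ip B (ξ j) ((π (wordInner (j :: w) [] w' l')).1 e')
  | w, e :: l, w', [] => ∑ j, ip B e ((π (wordInner w l (j :: w') [])).1 (ξ j))
  | w, e :: l, w', e' :: l' => ip B e ((π (wordInner w l w' l')).1 e')
termination_by _ l _ l' => l.length + l'.length

theorem star_wordInner (w : List (Fin (m + 1))) (l : List E) (w' : List (Fin (m + 1)))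
    (l' : List E) : star (wordInner π ξ w l w' l') = wordInner π ξ w' l' w l := by
  induction w, l, w', l' using wordInner.induct (m := m) with
  | case1 w => simp [wordInner]
  | case2 w w' h => simp [wordInner, h, Ne.symm h]
  | case3 w w' e' l' ih =>
    rw [wordInner, wordInner, star_sum]
    exact Finset.sum_congr rfl fun j _ => by rw [star_ip_apply, ih]
  | case4 w e l w' ih =>
    rw [wordInner, wordInner, star_sum]
    exact Finset.sum_congr rfl fun j _ => by rw [star_ip_apply, ih]
  | case5 w e l w' e' l' ih => rw [wordInner, wordInner, star_ip_apply, ih]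

/-- The `j`-th left tensor factor of a vector, after splitting off one factor `E`. -/
def wordInit : List (Fin (m + 1)) × List E → Fin (m + 1) → List (Fin (m + 1)) × List E
  | (w, []), j => (j :: w, [])
  | (w, _ :: l), _ => (w, l)

/-- The `j`-th right tensor factor of a vector, after splitting off one factor `E`. -/
def wordLast : List (Fin (m + 1)) × List E → Fin (m + 1) → E
  | (_, []), j => ξ j
  -- A nonempty list needs a single term; it is put at index `0` and padded by zeros so that both
  -- cases are sums over `Fin (m + 1)`.
  | (_, e :: _), j => if j = 0 then e else 0

variable {π ξ}

/-- The identity behind `F = F ⊙ E`. If a list is nonempty, only the index `0` survives and the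
recursion for `wordInner` remains. The one case with content is two empty lists: orthonormality of
words leaves `∑ j, ⟨ξ j, ξ j⟩`, which is `1`, so `δ_w ↦ ∑ j, δ_{jw} ⊙ ξ j` is isometric. -/
theorem wordInner_eq_sum (hπ : π 1 = 1) (hξ : ∑ j, ip B (ξ j) (ξ j) = 1)
    (s s' : List (Fin (m + 1)) × List E) :
    wordInner π ξ s.1 s.2 s'.1 s'.2 = ∑ j, ∑ j', ip B (wordLast ξ s j)
      ((π (wordInner π ξ (wordInit s j).1 (wordInit s j).2 (wordInit s' j').1
        (wordInit s' j').2)).1 (wordLast ξ s' j')) := by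
  obtain ⟨w, _ | ⟨e, l⟩⟩ := s <;> obtain ⟨w', _ | ⟨e', l'⟩⟩ := s'
  · have h : ∀ j j', ip B (ξ j) ((π (if j :: w = j' :: w' then 1 else 0)).1 (ξ j')) =
        if j = j' then (if w = w' then ip B (ξ j) (ξ j) else 0) else 0 := by
      intro j j'
      by_cases hj : j = j' <;> by_cases hw : w = w' <;> simp [hj, hw, hπ]
    simp only [wordInit, wordLast, wordInner, h, Finset.sum_ite_eq, Finset.mem_univ, if_true]
    by_cases hw : w = w' <;> simp [hw, hξ]
  · simp only [wordInit, wordLast]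
    rw [wordInner]
    refine Finset.sum_congr rfl fun j _ => ?_
    rw [Finset.sum_eq_single 0] <;> simp +contextual
  · simp only [wordInit, wordLast]
    rw [wordInner]
    symm
    rw [Finset.sum_eq_single 0] <;> simp +contextual
  · simp only [wordInit, wordLast]
    rw [wordInner, Finset.sum_eq_single 0, Finset.sum_eq_single 0] <;> simp +contextual

/-- On bare words the kernel is a Kronecker delta, so collecting the coefficients of each word `v`
into `c v` turns the form into `∑ v, c v* c v`. -/
theorem wordInner_nonneg_zero {ι : Type} [Fintype ι] (w : ι → List (Fin (m + 1))) (b : ι → B) :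
    0 ≤ ∑ i, ∑ j, star (b i) * wordInner π ξ (w i) [] (w j) [] * b j := by
  classical
  let c : List (Fin (m + 1)) → B := fun v => ∑ i, if w i = v then b i else 0
  have h : ∑ i, ∑ j, star (b i) * wordInner π ξ (w i) [] (w j) [] * b j =
      ∑ v ∈ Finset.univ.image w, star (c v) * c v := by
    have h1 : ∀ i j, star (b i) * wordInner π ξ (w i) [] (w j) [] * b j =
        ∑ v ∈ Finset.univ.image w,
          star (if w i = v then b i else 0) * (if w j = v then b j else 0) := by
      intro i j
      rw [wordInner, Finset.sum_eq_single (w i)]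
      · by_cases hw : w i = w j <;> simp [hw, eq_comm]
      · intro v _ hv
        simp [Ne.symm hv]
      · intro hi
        exact absurd (Finset.mem_image_of_mem w (Finset.mem_univ i)) hi
    simp only [h1, c, star_sum, Finset.sum_mul_sum]
    exact (Finset.sum_congr rfl fun i _ => Finset.sum_comm).trans Finset.sum_comm
  rw [h]
  exact Finset.sum_nonneg fun v _ => star_mul_self_nonneg _

/-- Induction on a bound for the list lengths. Splitting off one factor of `E` shortens nonempty
lists and keeps empty ones empty, so the kernel at the initial parts is positive, and complete
positivity of `π` carries this over to the whole vectors. -/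
theorem wordInner_nonneg (hπ : π 1 = 1) (hξ : ∑ j, ip B (ξ j) (ξ j) = 1) (N : ℕ) :
    ∀ {ι : Type} [Fintype ι] (p : ι → List (Fin (m + 1)) × List E) (b : ι → B),
      (∀ i, (p i).2.length ≤ N) →
      0 ≤ ∑ i, ∑ j, star (b i) * wordInner π ξ (p i).1 (p i).2 (p j).1 (p j).2 * b j := by
  induction N with
  | zero =>
    intro ι _ p b hp
    have hp' : ∀ i, (p i).2 = [] := fun i => List.length_eq_zero_iff.1 (Nat.le_zero.1 (hp i))
    simp only [hp']
    exact wordInner_nonneg_zero _ b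
  | succ N ih =>
    intro ι _ p b hp
    let q : ι × Fin (m + 1) → List (Fin (m + 1)) × List E := fun a => wordInit (p a.1) a.2
    have hq : ∀ a, (q a).2.length ≤ N := by
      rintro ⟨i, j⟩
      have := hp i
      change (wordInit (p i) j).2.length ≤ N
      generalize p i = s at this
      obtain ⟨w, _ | ⟨e, l⟩⟩ := s
      · simp [wordInit]
      · simpa [wordInit] using this
    have h := sum_ip_nonneg π
      (fun a a' => wordInner π ξ (q a).1 (q a).2 (q a').1 (q a').2)
      (fun a a' => star_wordInner π ξ _ _ _ _) (fun c => ih q c hq)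
      (fun a => wordLast ξ (p a.1) a.2 <• b a.1)
    have h1 : ∀ i j, star (b i) * wordInner π ξ (p i).1 (p i).2 (p j).1 (p j).2 * b j =
        ∑ k, ∑ k', ip B (wordLast ξ (p i) k <• b i) ((π (wordInner π ξ (q (i, k)).1 (q (i, k)).2
          (q (j, k')).1 (q (j, k')).2)).1 (wordLast ξ (p j) k' <• b j)) := by
      intro i j
      rw [wordInner_eq_sum hπ hξ]
      simp only [ba_rmul, ip_mul_left, ip_mul_right, Finset.mul_sum, Finset.sum_mul, mul_assoc, q]
    simp only [h1]
    simp only [Fintype.sum_prod_type] at h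
    refine h.trans_eq (Finset.sum_congr rfl fun i _ => Finset.sum_comm)

variable (π ξ) in
/-- The positive definite kernel of the inductive limit of the modules `B^∞ ⊙ E^{⊙ n}`. -/
noncomputable def wordKernel (hπ : π 1 = 1) (hξ : ∑ j, ip B (ξ j) (ξ j) = 1) :
    PosKernel B (List (Fin (m + 1)) × List E) where
  toFun s s' := wordInner π ξ s.1 s.2 s'.1 s'.2
  star_apply _ _ := star_wordInner π ξ _ _ _ _
  nonneg _ _ p b := wordInner_nonneg hπ hξ (Finset.univ.sup fun i => (p i).2.length) p b
    fun i => Finset.le_sup (f := fun i => (p i).2.length) (Finset.mem_univ i)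

/-- A correspondence with a finite unit system `ξ` admits a full module `F` with
`F ⊙ E = F`. -/
theorem exists_total_tensorMap (hπ : π 1 = 1) (hξ : ∑ j, ip B (ξ j) (ξ j) = 1) :
    ∃ t : KernelModule (wordKernel π ξ hπ hξ) → E → KernelModule (wordKernel π ξ hπ hξ),
      IsTensorMap π t ∧
      IsTotal fun p : KernelModule (wordKernel π ξ hπ hξ) × E => t p.1 p.2 := by
  have hK : ∀ s s', (wordKernel π ξ hπ hξ).toFun s s' = wordInner π ξ s.1 s.2 s'.1 s'.2 :=
    fun _ _ => rfl
  generalize wordKernel π ξ hπ hξ = K at hK ⊢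
  let g : (List (Fin (m + 1)) × List E) × B → KernelModule K :=
    fun p => (KernelModule.point p.1 : KernelModule K) <• p.2
  -- `h₀ s` is the intended image of the generator `s` under `F → F ⊙ E`.
  let h₀ : List (Fin (m + 1)) × List E → KernelModule (tensorKernel (KernelModule K) π) :=
    fun s => ∑ j, tmul π (KernelModule.point (wordInit s j) : KernelModule K) (wordLast ξ s j)
  let h : (List (Fin (m + 1)) × List E) × B →
      KernelModule (tensorKernel (KernelModule K) π) := fun p => h₀ p.1 <• p.2
  have ht : IsTensorMap π (tmul π : KernelModule K → E →
      KernelModule (tensorKernel (KernelModule K) π)) := isTensorMap_tmul π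
  have hg : IsTotal g := KernelModule.isTotal K
  have htot : IsTotal fun p : KernelModule K × E =>
      (tmul π p.1 p.2 : KernelModule (tensorKernel (KernelModule K) π)) := by
    refine (KernelModule.isTotal (tensorKernel (KernelModule K) π)).of_mem fun p => ?_
    apply Submodule.le_topologicalClosure
    exact Submodule.subset_span ⟨(p.1.1, p.1.2 <• p.2), ht.rmul_right _ _ _⟩
  have hgh : ∀ p q, ip B (g p) (g q) = ip B (h p) (h q) := by
    intro p q
    simp only [g, h, h₀, ip_mul_left, ip_mul_right, ip_sum_left, ip_sum_right, ht _ _ _ _,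
      KernelModule.ip_point]
    rw [hK, wordInner_eq_sum hπ hξ, Finset.sum_comm]
    simp only [hK, Finset.mul_sum]
  -- Surjectivity: `(w, l) b ⊙ e = (w, l) ⊙ π(b) e` is the image of the generator `(w, π(b) e ::
  -- l)`.
  have hh : IsTotal h := by
    refine htot.of_mem fun p => ?_
    obtain ⟨x, e⟩ := p
    let M := (Submodule.span ℂ (Set.range h)).topologicalClosure
    refine hg.mem (M := M.comap (ht.leftCLM hπ e).toLinearMap)
      ((Submodule.isClosed_topologicalClosure _).preimage (ht.leftCLM hπ e).continuous) ?_ x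
    rintro ⟨⟨w, l⟩, b⟩
    change tmul π ((KernelModule.point (w, l) : KernelModule K) <• b) e ∈ M
    rw [ht.rmul_left]
    apply Submodule.le_topologicalClosure
    refine Submodule.subset_span ⟨((w, (π b).1 e :: l), 1), ?_⟩
    have h0 : ∀ x : KernelModule K, tmul π x (0 : E) = 0 := fun x => (ht.rightCLM hπ x).map_zero
    simp only [h, h₀, MulOpposite.op_one, one_smul, wordInit, wordLast]
    rw [Finset.sum_eq_single 0] <;> simp +contextual [h0]
  obtain ⟨U, -, hU⟩ := exists_unitary hg hh hgh
  have hUs : ∀ x y, ip B (U.symm x) (U.symm y) = ip B x y := fun x y => by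
    rw [← hU, U.apply_symm_apply, U.apply_symm_apply]
  refine ⟨fun x e => U.symm (tmul π x e), fun x e x' e' => (hUs _ _).trans (ht x e x' e'), ?_⟩
  refine Submodule.eq_top_iff'.2 fun x => ?_
  have hx := htot.mem (M := (Submodule.span ℂ (Set.range fun p : KernelModule K × E =>
    U.symm (tmul π p.1 p.2))).topologicalClosure.comap (U.symm.toLinearMap))
    ((Submodule.isClosed_topologicalClosure _).preimage U.symm.continuous)
    (fun p => Submodule.le_topologicalClosure _ (Submodule.subset_span ⟨p, rfl⟩)) (U x)
  simpa using hx

theorem isFull_wordModule (hπ : π 1 = 1) (hξ : ∑ j, ip B (ξ j) (ξ j) = 1) :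
    IsFull B (KernelModule (wordKernel π ξ hπ hξ)) := by
  refine Submodule.eq_top_iff'.2 fun b => Submodule.le_topologicalClosure _
    (Submodule.subset_span ⟨(KernelModule.point ([], []), KernelModule.point ([], []) <• b), ?_⟩)
  change ip B _ (_ <• b) = b
  rw [ip_mul_right, KernelModule.ip_point]
  change wordInner π ξ _ _ _ _ * b = b
  simp [wordInner]

end WordKernel

/-! ### The amplification `a ↦ a ⊙ id`. -/

section Amplification

variable {B : Type u} [CStarAlgebra B] [PartialOrder B] [StarOrderedRing B]
variable {E : Type v} [NormedAddCommGroup E] [NormedSpace ℂ E] [Module Bᵐᵒᵖ E]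
  [CStarModule Bᵐᵒᵖ E]
variable {F : Type w} [NormedAddCommGroup F] [NormedSpace ℂ F] [Module Bᵐᵒᵖ F]
  [CStarModule Bᵐᵒᵖ F]
variable {G : Type*} [NormedAddCommGroup G] [NormedSpace ℂ G] [Module Bᵐᵒᵖ G]
  [CStarModule Bᵐᵒᵖ G]

/-- If `f n ^ 2 ≤ f 0 * f (2 * n)` and `f` grows at most like `M ^ n`, then `f 1 ≤ M * f 0`. -/
theorem apply_one_le_of_sq_le {f : ℕ → ℝ} (hf : ∀ n, 0 ≤ f n)
    (hsq : ∀ n, f n ^ 2 ≤ f 0 * f (2 * n)) {C M : ℝ} (hM : 0 ≤ M)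
    (hC : ∀ n, f n ≤ C * M ^ n) : f 1 ≤ M * f 0 := by
  -- The hypothesis is iterated along `n = 1, 2, 4, …`.
  have h1 : ∀ k : ℕ, f 0 * f 1 ^ 2 ^ k ≤ f 0 ^ 2 ^ k * f (2 ^ k) := by
    intro k
    induction k with
    | zero => simp
    | succ k ih =>
      rcases (hf 0).eq_or_lt with h0 | h0
      · rw [← h0]
        simp
      · have h2 : (f 0 * f 1 ^ 2 ^ k) ^ 2 ≤ (f 0 ^ 2 ^ k * f (2 ^ k)) ^ 2 :=
          pow_le_pow_left₀ (mul_nonneg h0.le (pow_nonneg (hf 1) _)) ih 2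
        have h3 : f 0 * (f 0 * f 1 ^ 2 ^ (k + 1)) ≤
            f 0 * (f 0 ^ 2 ^ (k + 1) * f (2 ^ (k + 1))) := by
          calc f 0 * (f 0 * f 1 ^ 2 ^ (k + 1)) = (f 0 * f 1 ^ 2 ^ k) ^ 2 := by ring
            _ ≤ (f 0 ^ 2 ^ k * f (2 ^ k)) ^ 2 := h2
            _ = f 0 ^ 2 ^ (k + 1) * f (2 ^ k) ^ 2 := by ring
            _ ≤ f 0 ^ 2 ^ (k + 1) * (f 0 * f (2 * 2 ^ k)) := by gcongr; exact hsq _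
            _ = _ := by rw [pow_succ' 2 k]; ring
        exact le_of_mul_le_mul_left h3 h0
  by_contra! h
  have h0 : 0 < f 0 := by
    refine (hf 0).lt_of_ne fun h0 => ?_
    have h4 := hsq 1
    rw [← h0, zero_mul] at h4
    rw [← h0, mul_zero] at h
    nlinarith
  have h1p : 0 < f 1 := (mul_nonneg hM h0.le).trans_lt h
  -- If `M f 0 < f 1`, the right side tends to `0`, contradicting `0 < f 0`.
  have h5 : ∀ k : ℕ, f 0 ≤ C * (M * f 0 / f 1) ^ 2 ^ k := by
    intro k
    rw [div_pow, ← mul_div_assoc, le_div_iff₀ (pow_pos h1p _)]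
    calc f 0 * f 1 ^ 2 ^ k ≤ f 0 ^ 2 ^ k * f (2 ^ k) := h1 k
      _ ≤ f 0 ^ 2 ^ k * (C * M ^ 2 ^ k) := by gcongr; exact hC _
      _ = _ := by ring
  have h6 : Filter.Tendsto (fun k : ℕ => C * (M * f 0 / f 1) ^ 2 ^ k) Filter.atTop (nhds 0) := by
    have h7 := (tendsto_pow_atTop_nhds_zero_of_lt_one (div_nonneg (mul_nonneg hM h0.le) h1p.le)
      ((div_lt_one h1p).2 h)).comp (tendsto_pow_atTop_atTop_of_one_lt (one_lt_two (α := ℕ)))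
    simpa using h7.const_mul C
  exact absurd (ge_of_tendsto' h6 h5) (not_le.2 h0)

theorem ba_norm_apply_le (a : Ba B F) (x : F) : ‖a.1 x‖ ≤ ‖a‖ * ‖x‖ := a.1.le_opNorm x

theorem ba_norm_star_apply_le (a : Ba B F) (x : F) : ‖(star a : Ba B F).1 x‖ ≤ ‖a‖ * ‖x‖ := by
  set z := (star a : Ba B F).1 x with hz
  have h : ‖z‖ ^ 2 ≤ ‖a‖ * ‖z‖ * ‖x‖ := by
    rw [norm_sq_eq (B := B)]
    nth_rewrite 2 [hz]
    rw [ip_star_right]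
    exact (norm_ip_le _ _).trans (by gcongr; exact ba_norm_apply_le a z)
  rcases (norm_nonneg z).eq_or_lt with h0 | h0
  · rw [← h0]
    positivity
  · nlinarith

theorem ba_norm_star_le (a : Ba B F) : ‖star a‖ ≤ ‖a‖ :=
  ContinuousLinearMap.opNorm_le_bound _ (norm_nonneg _) (ba_norm_star_apply_le a)

variable {π : B →⋆ₙₐ[ℂ] Ba B E} {t : F → E → G}

variable (t) in
/-- The map `∑ c (x ⊙ y) ↦ ∑ c (a x ⊙ y)` on formal linear combinations. -/
noncomputable def preAmp (a : Ba B F) : (F × E →₀ ℂ) →ₗ[ℂ] G :=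
  Finsupp.linearCombination ℂ fun p => t (a.1 p.1) p.2

theorem IsTensorMap.ip_preAmp (ht : IsTensorMap π t) (a b c d : Ba B F)
    (h : star a * b = star c * d) (v w : F × E →₀ ℂ) :
    ip B (preAmp t a v) (preAmp t b w) = ip B (preAmp t c v) (preAmp t d w) := by
  refine ip_linearCombination (fun p q => ?_) v w
  rw [ht, ht, ip_apply_left a, ip_apply_left c]
  have h1 := congrArg (fun a : Ba B F => a.1 q.1) h
  simp only [ba_mul_apply] at h1
  rw [h1]

/-- The estimate makes `a ⊙ id` well defined and contractive, without functional calculus in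
`𝓑ᵃ(F)`. For `h = a* a` and `f n = ‖(hⁿ ⊙ id) v‖`, Cauchy–Schwarz gives `f n ² ≤ f 0 * f (2 n)`,
while a termwise bound gives growth at most `‖a‖^(2n)`. Hence `f 1 ≤ ‖a‖² f 0`, and `‖(a ⊙ id) v‖² ≤
f 0 * f 1`. -/
theorem IsTensorMap.norm_preAmp_le (ht : IsTensorMap π t) (hπ : π 1 = 1) (a : Ba B F)
    (v : F × E →₀ ℂ) : ‖preAmp t a v‖ ≤ ‖a‖ * ‖preAmp t (1 : Ba B F) v‖ := by
  let h : Ba B F := star a * a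
  have hs : star h = h := by simp [h]
  let f : ℕ → ℝ := fun n => ‖preAmp t (h ^ n) v‖
  have hpow : ∀ (n : ℕ) (x : F), ‖(h ^ n).1 x‖ ≤ (‖a‖ ^ 2) ^ n * ‖x‖ := by
    intro n x
    induction n with
    | zero => simp
    | succ n ih =>
      rw [pow_succ', pow_succ', ba_mul_apply]
      change ‖(star a : Ba B F).1 (a.1 ((h ^ n).1 x))‖ ≤ _
      calc _ ≤ ‖a‖ * (‖a‖ * ‖(h ^ n).1 x‖) := (ba_norm_star_apply_le _ _).trans (by
            gcongr
            exact ba_norm_apply_le _ _)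
        _ ≤ ‖a‖ * (‖a‖ * ((‖a‖ ^ 2) ^ n * ‖x‖)) := by gcongr
        _ = _ := by ring
  have h1 : f 1 ≤ ‖a‖ ^ 2 * f 0 := by
    refine apply_one_le_of_sq_le (f := f) (C := ∑ p ∈ v.support, ‖v p‖ * (‖p.1‖ * ‖p.2‖))
      (fun n => norm_nonneg _) (fun n => ?_) (by positivity) (fun n => ?_)
    · change ‖preAmp t (h ^ n) v‖ ^ 2 ≤ ‖preAmp t (h ^ 0) v‖ * ‖preAmp t (h ^ (2 * n)) v‖
      rw [norm_sq_eq (B := B), ht.ip_preAmp (h ^ n) (h ^ n) (h ^ 0) (h ^ (2 * n))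
        (by rw [star_pow, hs, two_mul, pow_add]; simp)]
      exact norm_ip_le _ _
    · change ‖preAmp t (h ^ n) v‖ ≤ _
      rw [preAmp, Finsupp.linearCombination_apply, Finset.sum_mul]
      refine norm_sum_le_of_le _ fun p _ => ?_
      rw [norm_smul, mul_assoc]
      gcongr
      calc _ ≤ ‖(h ^ n).1 p.1‖ * ‖p.2‖ := ht.norm_le hπ _ _
        _ ≤ ((‖a‖ ^ 2) ^ n * ‖p.1‖) * ‖p.2‖ := by gcongr; exact hpow n _
        _ = _ := by ring
  have h2 : ‖preAmp t a v‖ ^ 2 ≤ f 0 * f 1 := by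
    rw [norm_sq_eq (B := B), ht.ip_preAmp a a (h ^ 0) (h ^ 1) (by simp [h])]
    exact norm_ip_le _ _
  have h3 : f 0 = ‖preAmp t (1 : Ba B F) v‖ := by simp [f]
  refine le_of_sq_le_sq (h2.trans ?_) (by positivity)
  calc f 0 * f 1 ≤ f 0 * (‖a‖ ^ 2 * f 0) := by gcongr
    _ = _ := by rw [h3]; ring

variable [CompleteSpace G]

variable (t) in
/-- The bounded operator `a ⊙ id`. -/
noncomputable def ampCLM (a : Ba B F) : G →L[ℂ] G :=
  (preAmp t a).extendOfNorm (preAmp t (1 : Ba B F))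

theorem ampCLM_preAmp (ht : IsTensorMap π t) (hπ : π 1 = 1)
    (htot : IsTotal fun p : F × E => t p.1 p.2) (a : Ba B F) (v : F × E →₀ ℂ) :
    ampCLM t a (preAmp t (1 : Ba B F) v) = preAmp t a v :=
  LinearMap.extendOfNorm_eq htot.denseRange ⟨_, ht.norm_preAmp_le hπ a⟩ v

theorem ampCLM_apply (ht : IsTensorMap π t) (hπ : π 1 = 1)
    (htot : IsTotal fun p : F × E => t p.1 p.2) (a : Ba B F) (x : F) (y : E) :
    ampCLM t a (t x y) = t (a.1 x) y := by
  simpa [preAmp] using ampCLM_preAmp ht hπ htot a (Finsupp.single (x, y) 1)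

theorem norm_ampCLM_le (ht : IsTensorMap π t) (hπ : π 1 = 1)
    (htot : IsTotal fun p : F × E => t p.1 p.2) (a : Ba B F) : ‖ampCLM t a‖ ≤ ‖a‖ :=
  LinearMap.opNorm_extendOfNorm_le htot.denseRange (norm_nonneg _) (ht.norm_preAmp_le hπ a)

theorem ip_ampCLM_left (ht : IsTensorMap π t) (hπ : π 1 = 1)
    (htot : IsTotal fun p : F × E => t p.1 p.2) (a : Ba B F) (z w : G) :
    ip B (ampCLM t a z) w = ip B z (ampCLM t (star a) w) := by
  refine DenseRange.induction_on₂ (e := preAmp t (1 : Ba B F))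
    (p := fun z w => ip B (ampCLM t a z) w = ip B z (ampCLM t (star a) w))
    htot.denseRange ?_ ?_ z w
  · have h1 : Continuous fun p : G × G => ip B (ampCLM t a p.1) p.2 :=
      continuous_ip.comp (f := fun p : G × G => (ampCLM t a p.1, p.2)) (by fun_prop)
    have h2 : Continuous fun p : G × G => ip B p.1 (ampCLM t (star a) p.2) :=
      continuous_ip.comp (f := fun p : G × G => (p.1, ampCLM t (star a) p.2)) (by fun_prop)
    exact isClosed_eq h1 h2
  · intro v w
    rw [ampCLM_preAmp ht hπ htot, ampCLM_preAmp ht hπ htot, ht.ip_preAmp a 1 1 (star a)]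
    simp

/-- The representation `a ↦ a ⊙ id` of `𝓑ᵃ(F)` on `F ⊙ E`. -/
noncomputable def amplification (ht : IsTensorMap π t) (hπ : π 1 = 1)
    (htot : IsTotal fun p : F × E => t p.1 p.2) : Ba B F →⋆ₐ[ℂ] Ba B G where
  toFun a := ⟨ampCLM t a, ampCLM t (star a), ip_ampCLM_left ht hπ htot a⟩
  map_one' := Subtype.ext <| htot.clm_ext fun p => by
    simp [ampCLM_apply ht hπ htot]
  map_mul' a b := Subtype.ext <| htot.clm_ext fun p => by
    simp [ampCLM_apply ht hπ htot]
  map_zero' := Subtype.ext <| htot.clm_ext fun p => by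
    have h := (ht.leftCLM hπ p.2).map_zero
    rw [ht.leftCLM_apply] at h
    simp [ampCLM_apply ht hπ htot, h]
  map_add' a b := Subtype.ext <| htot.clm_ext fun p => by
    simp [ampCLM_apply ht hπ htot, ht.add_left]
  commutes' c := Subtype.ext <| htot.clm_ext fun p => by
    simp only [ampCLM_apply ht hπ htot, Algebra.algebraMap_eq_smul_one]
    exact ht.smul_left c p.1 p.2
  map_star' a := eq_star_of_ip fun x y => (ip_ampCLM_left ht hπ htot a x y).symm

theorem amplification_apply (ht : IsTensorMap π t) (hπ : π 1 = 1)
    (htot : IsTotal fun p : F × E => t p.1 p.2) (a : Ba B F) (x : F) (y : E) :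
    (amplification ht hπ htot a).1 (t x y) = t (a.1 x) y :=
  ampCLM_apply ht hπ htot a x y

theorem norm_amplification_le (ht : IsTensorMap π t) (hπ : π 1 = 1)
    (htot : IsTotal fun p : F × E => t p.1 p.2) (a : Ba B F) :
    ‖amplification ht hπ htot a‖ ≤ ‖a‖ :=
  norm_ampCLM_le ht hπ htot a

open Filter Topology

/-- Bounded nets of operators converge pointwise if they converge on a total set. -/
theorem IsTotal.tendsto_apply {α I : Type*} {l : Filter α} {g : I → G} (hg : IsTotal g)
    {A : α → G →L[ℂ] G} {A₀ : G →L[ℂ] G} {R : ℝ} (hR : ∀ᶠ i in l, ‖A i‖ ≤ R)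
    (h : ∀ j, Tendsto (fun i => A i (g j)) l (𝓝 (A₀ (g j)))) (z : G) :
    Tendsto (fun i => A i z) l (𝓝 (A₀ z)) := by
  refine hg.mem (M :=
    { carrier := {z | Tendsto (fun i => A i z) l (𝓝 (A₀ z))}
      add_mem' := fun {x y} hx hy => by
        simp only [Set.mem_ofPred_eq, map_add] at *
        exact hx.add hy
      zero_mem' := by simpa using tendsto_const_nhds
      smul_mem' := fun c x hx => by
        simp only [Set.mem_ofPred_eq, map_smul] at *
        exact hx.const_smul c }) ?_ h z
  refine isClosed_of_closure_subset fun z hz => ?_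
  change Tendsto (fun i => A i z) l (𝓝 (A₀ z))
  rw [Metric.tendsto_nhds]
  intro ε hε
  let D := |R| + ‖A₀‖ + 1
  have hD : 0 < D := by positivity
  -- The tolerance is chosen so that the two errors from replacing `z` by `x`, at most `|R| ‖z - x‖`
  -- and `‖A₀‖ ‖z - x‖`, together stay below `ε / 2`; the `+ 1` in `D` keeps it positive.
  obtain ⟨x, hx, hzx⟩ := Metric.mem_closure_iff.1 hz (ε / (2 * D)) (by positivity)
  have hx' := Metric.tendsto_nhds.1 (show Tendsto (fun i => A i x) l (𝓝 (A₀ x)) from hx)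
    (ε / 2) (by positivity)
  filter_upwards [hR, hx'] with i hi hxi
  rw [dist_eq_norm] at hxi hzx ⊢
  have h1 : A i z - A₀ z = A i (z - x) + (A i x - A₀ x) - A₀ (z - x) := by
    simp only [map_sub]
    abel
  have h2 : ‖A i (z - x)‖ ≤ |R| * ‖z - x‖ :=
    (A i).le_of_opNorm_le (hi.trans (le_abs_self R)) _
  have h3 : ‖A₀ (z - x)‖ ≤ ‖A₀‖ * ‖z - x‖ := A₀.le_opNorm _
  have h4 : D * ‖z - x‖ < ε / 2 := by
    calc D * ‖z - x‖ < D * (ε / (2 * D)) := by gcongr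
      _ = ε / 2 := by field_simp
  have h5 : 0 ≤ ‖z - x‖ := norm_nonneg _
  calc ‖A i z - A₀ z‖ ≤ ‖A i (z - x)‖ + ‖A i x - A₀ x‖ + ‖A₀ (z - x)‖ := by
        rw [h1]
        exact (norm_sub_le _ _).trans (add_le_add_left (norm_add_le _ _) _)
    _ ≤ |R| * ‖z - x‖ + ‖A i x - A₀ x‖ + ‖A₀‖ * ‖z - x‖ := by gcongr
    _ < ε := by
      have : D * ‖z - x‖ = |R| * ‖z - x‖ + ‖A₀‖ * ‖z - x‖ + ‖z - x‖ := by ring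
      linarith

end Amplification

/-! ### Strictness, the correspondence of the amplification, unit systems and fullness. -/

section Correspondence

variable {B : Type u} [CStarAlgebra B] [PartialOrder B] [StarOrderedRing B]
variable {E : Type v} [NormedAddCommGroup E] [NormedSpace ℂ E] [Module Bᵐᵒᵖ E]
  [CStarModule Bᵐᵒᵖ E]
variable {F : Type w} [NormedAddCommGroup F] [NormedSpace ℂ F] [Module Bᵐᵒᵖ F]
  [CStarModule Bᵐᵒᵖ F]

-- On bounded sets contractivity reduces strict convergence to elementary tensors, where it is
-- continuity of `x ↦ x ⊙ y`. Adjoints are treated alike, since `(a ⊙ id)* = a* ⊙ id`.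
open Filter Topology in
theorem isStrict_amplification [CompleteSpace F] {π : B →⋆ₙₐ[ℂ] Ba B E} {t : F → E → F}
    (ht : IsTensorMap π t) (hπ : π 1 = 1) (htot : IsTotal fun p : F × E => t p.1 p.2) :
    IsStrict (amplification ht hπ htot) := by
  intro S hS a₀ _
  obtain ⟨R, hR⟩ := hS.exists_norm_le
  let l : Filter (Ba B F) := @nhdsWithin _ (strictTopology B F) a₀ S
  have hmem : ∀ᶠ a in l, a ∈ S := @self_mem_nhdsWithin _ (strictTopology B F) a₀ S
  have hle : l ≤ @nhds _ (strictTopology B F) a₀ := inf_le_left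
  rw [nhds_induced] at hle
  have hl : Tendsto (fun a : Ba B F => ((fun x : F => a.1 x), fun x : F => (star a : Ba B F).1 x))
      l (𝓝 ((fun x : F => a₀.1 x), fun x : F => (star a₀ : Ba B F).1 x)) :=
    tendsto_comap.mono_left hle
  have h1 : ∀ x, Tendsto (fun a : Ba B F => a.1 x) l (𝓝 (a₀.1 x)) := fun x =>
    tendsto_pi_nhds.1 ((continuous_fst.tendsto _).comp hl) x
  have h2 : ∀ x, Tendsto (fun a : Ba B F => (star a : Ba B F).1 x) l
      (𝓝 ((star a₀ : Ba B F).1 x)) := fun x =>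
    tendsto_pi_nhds.1 ((continuous_snd.tendsto _).comp hl) x
  have key : ∀ (A : Ba B F → Ba B F) (A₀ : Ba B F), (∀ᶠ a in l, ‖A a‖ ≤ R) →
      (∀ x, Tendsto (fun a => (A a).1 x) l (𝓝 (A₀.1 x))) → ∀ z,
      Tendsto (fun a => (amplification ht hπ htot (A a)).1 z) l
        (𝓝 ((amplification ht hπ htot A₀).1 z)) := by
    intro A A₀ hA h z
    refine htot.tendsto_apply (R := R)
      (hA.mono fun a ha => (norm_amplification_le ht hπ htot _).trans ha) (fun p => ?_) z
    have h3 := ((ht.leftCLM hπ p.2).continuous.tendsto _).comp (h p.1)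
    refine (h3.congr fun a => (amplification_apply ht hπ htot (A a) p.1 p.2).symm).trans ?_
    exact (congrArg 𝓝 (amplification_apply ht hπ htot A₀ p.1 p.2).symm).le
  change Tendsto (amplification ht hπ htot) l (@nhds _ (strictTopology B F) _)
  rw [nhds_induced, tendsto_comap_iff, nhds_prod_eq]
  refine Tendsto.prodMk ?_ ?_ <;> rw [tendsto_pi_nhds] <;> intro z
  · exact key id a₀ (hmem.mono fun a ha => hR a ha) h1 z
  · simp only [← map_star]
    exact key star (star a₀) (hmem.mono fun a ha => (ba_norm_star_le a).trans (hR a ha)) h2 z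

variable {G : Type*} [NormedAddCommGroup G] [NormedSpace ℂ G] [Module Bᵐᵒᵖ G]
  [CStarModule Bᵐᵒᵖ G]

theorem star_rankOne (x y : F) : star (rankOne x y : Ba B F) = rankOne y x :=
  (eq_star_of_ip fun z w => by
    change ip B z (y <• ip B x w) = ip B (x <• ip B y z) w
    rw [ip_mul_left, star_ip, ip_mul_right]).symm

/-- The operator `y ↦ x ⊙ y` into `F ⊙ E` is adjointable. -/
theorem IsTensorMap.exists_adjoint [CompleteSpace E] {π : B →⋆ₙₐ[ℂ] Ba B E} {t : F → E → G}
    (ht : IsTensorMap π t) (hπ : π 1 = 1) (htot : IsTotal fun p : F × E => t p.1 p.2) (x : F) :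
    ∃ L : G →L[ℂ] E, ∀ e y, ip B e (L y) = ip B (t x e) y := by
  let T : (F × E →₀ ℂ) →ₗ[ℂ] G := Finsupp.linearCombination ℂ fun p => t p.1 p.2
  -- The adjoint must send `x' ⊙ e` to `⟨x, x'⟩ e`. It is bounded because `‖f v‖² = ‖⟨x ⊙ f v, T
  -- v⟩‖`.
  let f : (F × E →₀ ℂ) →ₗ[ℂ] E :=
    Finsupp.linearCombination ℂ fun p => (π (ip B x p.1)).1 p.2
  have hf : ∀ e v, ip B e (f v) = ip B (t x e) (T v) := by
    intro e v
    simp only [f, T, Finsupp.linearCombination_apply, Finsupp.sum, ip_sum_right, ip_smul_right,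
      ht _ _ _ _]
  have hn : ∀ v, ‖f v‖ ≤ ‖x‖ * ‖T v‖ := by
    intro v
    have h1 : ‖f v‖ ^ 2 ≤ ‖x‖ * ‖f v‖ * ‖T v‖ := by
      rw [norm_sq_eq (B := B), hf]
      refine (norm_ip_le _ _).trans ?_
      gcongr
      exact ht.norm_le hπ _ _
    rcases (norm_nonneg (f v)).eq_or_lt with h0 | h0
    · rw [← h0]
      positivity
    · nlinarith
  refine ⟨f.extendOfNorm T, fun e y => ?_⟩
  refine htot.denseRange.induction_on (p := fun y => ip B e (f.extendOfNorm T y) = ip B (t x e) y)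
    y ?_ ?_
  · exact isClosed_eq ((continuous_ip_right e).comp (f.extendOfNorm T).continuous)
      (continuous_ip_right _)
  · intro v
    rw [← hf]
    congr 1
    exact LinearMap.extendOfNorm_eq htot.denseRange ⟨_, hn⟩ v

/-- If `F` is full and `F ⊙ E = F`, then `E` is the correspondence of `a ↦ a ⊙ id`. -/
theorem isCorrespondenceOf_amplification [CompleteSpace E] [CompleteSpace F]
    {π : B →⋆ₙₐ[ℂ] Ba B E} {t : F → E → F} (ht : IsTensorMap π t) (hπ : π 1 = 1)
    (htot : IsTotal fun p : F × E => t p.1 p.2) (hF : IsFull B F) :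
    IsCorrespondenceOf (amplification ht hπ htot) π := by
  choose L hL using ht.exists_adjoint hπ htot
  have hLt : ∀ x z e, L x (t z e) = (π (ip B x z)).1 e := fun x z e =>
    ext_ip (B := B) fun e' => by rw [hL, ht]
  -- Both sides send `y = z ⊙ e` to `x' ⊙ ⟨x, z⟩ e = x' ⟨x, z⟩ ⊙ e`.
  have hrank : ∀ x x' y, t x' (L x y) = (amplification ht hπ htot (rankOne x' x)).1 y := by
    intro x x' y
    have h : (ht.rightCLM hπ x').comp (L x) = (amplification ht hπ htot (rankOne x' x)).1 :=
      htot.clm_ext fun p => by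
        rw [amplification_apply]
        change t x' (L x (t p.1 p.2)) = t (x' <• ip B x p.1) p.2
        rw [hLt, ht.rmul_left]
    exact congrArg (fun a : F →L[ℂ] F => a y) h
  refine ⟨fun x y => L x y, fun b x y => ?_, fun x y x' y' => ?_, ?_⟩
  · refine ext_ip (B := B) fun e => ?_
    rw [hL, ht.rmul_left, ← hL, map_star, ip_apply_right]
  · rw [hL, hrank, ip_apply_left, ← map_star, star_rankOne]
  · refine Submodule.eq_top_iff'.2 fun e => ?_
    let M := (Submodule.span ℂ (Set.range fun p : F × F => L p.1 p.2)).topologicalClosure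
    let act : B →L[ℂ] E := LinearMap.mkContinuous
      { toFun := fun b => (π b).1 e
        map_add' := fun a b => by simp
        map_smul' := fun c a => by simp } ‖e‖
      fun b => (norm_rep_apply_le hπ b e).trans (mul_comm _ _).le
    -- Fullness of `F` enters here: all `⟨x, z⟩ e` lie in the closed span, hence so does `1 e = e`.
    have h := IsTotal.mem (g := fun p : F × F => ip B p.1 p.2) hF (M := M.comap act.toLinearMap)
      ((Submodule.isClosed_topologicalClosure _).preimage act.continuous)
      (fun p => Submodule.le_topologicalClosure _
        (Submodule.subset_span ⟨(p.1, t p.2 e), hLt _ _ _⟩)) 1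
    change (π 1).1 e ∈ M at h
    rwa [hπ] at h

/-- A full Hilbert module over a unital C⋆-algebra has a finite system of vectors whose squares
add up to `1`. -/
theorem IsFull.exists_unit_system (hE : IsFull B E) :
    ∃ (m : ℕ) (ξ : Fin (m + 1) → E), ∑ j, ip B (ξ j) (ξ j) = 1 := by
  classical
  have h1 : (1 : B) ∈ closure (Submodule.span ℂ (Set.range fun p : E × E => ip B p.1 p.2) :
      Set B) := by
    rw [← Submodule.topologicalClosure_coe, show _ = (⊤ : Submodule ℂ B) from hE]
    trivial
  obtain ⟨c, hc, hc1⟩ := Metric.mem_closure_iff.1 h1 1 one_pos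
  rw [dist_eq_norm] at hc1
  have hcu : IsUnit c := by
    have := (Units.oneSub (1 - c) hc1).isUnit
    rwa [Units.val_oneSub, sub_sub_cancel] at this
  obtain ⟨u, rfl⟩ := hcu
  obtain ⟨a, ha⟩ := (Finsupp.mem_span_range_iff_exists_finsupp).1 hc
  -- The scalars and the inverse of the invertible approximant of `1` are absorbed into the second
  -- vectors, so that `∑ ⟨x, z⟩ = 1` exactly.
  let z : E × E → E := fun p => (a p • p.2) <• (↑u⁻¹ : B)
  have hz : ∑ p ∈ a.support, ip B p.1 (z p) = 1 := by
    have h2 : ∀ p : E × E, ip B p.1 (z p) = (a p • ip B p.1 p.2) * (↑u⁻¹ : B) := fun p => by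
      simp only [z, ip_mul_right, ip_smul_right]
    simp only [h2]
    rw [← Finset.sum_mul]
    rw [Finsupp.sum] at ha
    rw [ha, Units.mul_inv]
  have hz' : ∑ p ∈ a.support, ip B (z p) p.1 = 1 := by
    simpa only [star_sum, star_ip, star_one] using congrArg star hz
  let d : B := ∑ p ∈ a.support, (ip B p.1 p.1 + ip B (z p) (z p))
  have hd : 1 ≤ d := by
    -- Polarization: `∑ ⟨x - z, x - z⟩ = d - 2`, so `d` is positive and invertible, and right
    -- multiplication by `d^(-1/2)` normalizes the vectors `x` and `z`.
    have h3 : d - (1 + 1) = ∑ p ∈ a.support, ip B (p.1 - z p) (p.1 - z p) := by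
      nth_rewrite 1 [← hz]
      rw [← hz']
      simp only [d, ip_sub_left, ip_sub_right]
      rw [← Finset.sum_add_distrib, ← Finset.sum_sub_distrib]
      exact Finset.sum_congr rfl fun p _ => by abel
    have h4 : 1 + 1 ≤ d := by
      rw [← sub_nonneg, h3]
      exact Finset.sum_nonneg fun p _ => ip_self_nonneg _
    exact (le_add_of_nonneg_right zero_le_one).trans h4
  have hd0 : 0 ≤ d := zero_le_one.trans hd
  have hdu : IsUnit d := CStarAlgebra.isUnit_of_le 1 hd
  have hsu : IsUnit (CFC.sqrt d) := by
    rw [← CFC.sqrt_mul_sqrt_self d hd0] at hdu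
    exact ((Commute.refl _).isUnit_mul_iff.1 hdu).1
  obtain ⟨s, hs⟩ := hsu
  let h : B := (↑s⁻¹ : B)
  have hh : star h * d * h = 1 := by
    have h5 : star (s : B) = s := by
      rw [hs]
      exact (IsSelfAdjoint.of_nonneg (CFC.sqrt_nonneg d)).star_eq
    have h6 : star h * s = 1 := by
      rw [← h5, ← star_mul]
      simp [h]
    rw [← CFC.sqrt_mul_sqrt_self d hd0, ← hs, ← mul_assoc, h6, one_mul]
    simp [h]
  let T := {p // p ∈ a.support}
  -- The extra zero vector keeps the system nonempty, so that it is indexed by some `Fin (m + 1)`.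
  let η : Option (T ⊕ T) → E :=
    fun o => o.elim 0 (Sum.elim (fun p => p.1.1 <• h) fun p => z p.1 <• h)
  let e : Fin (Fintype.card (T ⊕ T) + 1) ≃ Option (T ⊕ T) :=
    (Fintype.equivFinOfCardEq (by rw [Fintype.card_option])).symm
  refine ⟨_, fun j => η (e j), ?_⟩
  rw [e.sum_comp fun o => ip B (η o) (η o), Fintype.sum_option, Fintype.sum_sum_type]
  simp only [η, Option.elim, Sum.elim_inl, Sum.elim_inr, ip_zero_left, zero_add, ip_mul_left,
    ip_mul_right]
  rw [← Finset.sum_add_distrib, ← hh]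
  simp only [d, Finset.mul_sum, Finset.sum_mul]
  rw [← Finset.sum_coe_sort a.support]
  exact Finset.sum_congr rfl fun p _ => by simp only [mul_add, add_mul, mul_assoc]

/-- A Hilbert module `F` is full if a full Hilbert module is the correspondence of an
endomorphism of `𝓑ᵃ(F)`. -/
theorem isFull_of_isCorrespondenceOf {ϑ : Ba B F → Ba B F} {π : B → Ba B E} (hE : IsFull B E)
    (h : IsCorrespondenceOf ϑ π) : IsFull B F := by
  obtain ⟨t, ht⟩ := h
  have htot : IsTotal fun p : F × F => t p.1 p.2 := ht.total
  refine IsTotal.of_mem (g := fun p : E × E => ip B p.1 p.2) hE fun p => ?_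
  let M := (Submodule.span ℂ (Set.range fun p : F × F => ip B p.1 p.2)).topologicalClosure
  have hM : IsClosed (M : Set B) := Submodule.isClosed_topologicalClosure _
  change ip B p.1 p.2 ∈ M
  -- Totality in each variable reduces the claim to elementary tensors, whose inner products in `E`
  -- are inner products of vectors of `F`.
  refine htot.mem (M :=
    { carrier := {y | ip B p.1 y ∈ M}
      add_mem' := fun {a b} ha hb => by
        change ip B p.1 (a + b) ∈ M
        rw [ip_add_right]
        exact M.add_mem ha hb
      zero_mem' := by simp
      smul_mem' := fun c a ha => by
        change ip B p.1 (c • a) ∈ M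
        rw [ip_smul_right]
        exact M.smul_mem _ ha }) (hM.preimage (continuous_ip_right p.1)) (fun q => ?_) p.2
  change ip B p.1 (t q.1 q.2) ∈ M
  refine htot.mem (M :=
    { carrier := {x | ip B x (t q.1 q.2) ∈ M}
      add_mem' := fun {a b} ha hb => by
        change ip B (a + b) _ ∈ M
        rw [ip_add_left]
        exact M.add_mem ha hb
      zero_mem' := by simp
      smul_mem' := fun c a ha => by
        change ip B (c • a) _ ∈ M
        rw [ip_smul_left]
        exact M.smul_mem _ ha }) (hM.preimage (continuous_ip_left _)) (fun r => ?_) p.1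
  change ip B (t r.1 r.2) (t q.1 q.2) ∈ M
  rw [ht.inner_eq]
  exact Submodule.le_topologicalClosure _ (Submodule.subset_span ⟨(_, _), rfl⟩)

end Correspondence

end HilbMod

theorem theorem7p6
    {B : Type u} [CStarAlgebra B] [PartialOrder B] [StarOrderedRing B]
    {E : Type v} [NormedAddCommGroup E] [NormedSpace ℂ E] [Module Bᵐᵒᵖ E]
    [CStarModule Bᵐᵒᵖ E] [CompleteSpace E]
    (π : B →⋆ₙₐ[ℂ] HilbMod.Ba B E) (hπ : HilbMod.IsNondegenerate π)
    (hE : HilbMod.IsFull B E) :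
    (∃ (F : Type (max u v)) (_ : NormedAddCommGroup F) (_ : NormedSpace ℂ F)
      (_ : Module Bᵐᵒᵖ F) (_ : CStarModule Bᵐᵒᵖ F) (_ : CompleteSpace F)
      (ϑ : HilbMod.Ba B F →⋆ₐ[ℂ] HilbMod.Ba B F),
        HilbMod.IsFull B F ∧ HilbMod.IsStrict ϑ ∧
        HilbMod.IsCorrespondenceOf ϑ π ∧ HilbMod.IsAmplification ϑ π) ∧
    (∀ (F : Type w) [NormedAddCommGroup F] [NormedSpace ℂ F] [Module Bᵐᵒᵖ F]
      [CStarModule Bᵐᵒᵖ F] [CompleteSpace F]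
      (ϑ : HilbMod.Ba B F →⋆ₐ[ℂ] HilbMod.Ba B F),
        HilbMod.IsStrict ϑ → HilbMod.IsCorrespondenceOf ϑ π → HilbMod.IsFull B F) := by
  have h1 := HilbMod.map_one_of_nondegenerate hπ
  refine ⟨?_, fun F _ _ _ _ _ ϑ _ h => HilbMod.isFull_of_isCorrespondenceOf hE h⟩
  obtain ⟨m, ξ, hξ⟩ := hE.exists_unit_system
  obtain ⟨t, ht, htot⟩ := HilbMod.exists_total_tensorMap h1 hξ
  have hF := HilbMod.isFull_wordModule (B := B) h1 hξ
  exact ⟨HilbMod.KernelModule (HilbMod.wordKernel π ξ h1 hξ), inferInstance, inferInstance,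
    inferInstance, inferInstance, inferInstance, HilbMod.amplification ht h1 htot, hF,
    HilbMod.isStrict_amplification ht h1 htot,
    HilbMod.isCorrespondenceOf_amplification ht h1 htot hF, t,
    fun a x y => (HilbMod.amplification_apply ht h1 htot a x y).symm, ht, htot⟩
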